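/- **Setting.** $G$ is a finite connected simple undirected graph with $n$ nodes, $m$ edges and maximum degree $\Delta$. Nodes are anonymous and without memory; at a node of degree $\delta$ the incident edges carry distinct port labels $0,\dots,\delta-1$, and the two labels of an edge are unrelated. There are $k\le n$ robots with distinct labels from $[1,k]$, placed arbitrarily at the nodes. They know none of $n,m,\Delta$; a robot communicates only with robots at the same node, and knows the port through which it entered. The system is asynchronous: in an arbitrary order chosen by an adversary, robots execute single atomic steps. $\mathrm{MUTEX}(v)$ selects one of the undocked robots contending for node $v$, arbitrarily, and from then on always returns this robot. **Algorithm Helping-Async.** Initially every robot $i$ has $port\_entered=parent\_ptr=-1$, $state=explore$, $seen=0$. An undocked robot $i$ repeats the following iteration. Unless this is its first iteration, it sets $port\_entered$ and $parent\_ptr$ to its entry port and $seen\gets0$. (a) If $state=explore$ and no robot is docked at the node, it calls $\mathrm{MUTEX}$. If it wins, it docks ($state\gets settled$), initializes arrays $visited[1..k]\gets 0$, $entry\_port[1..k]\gets -1$, and leaves this loop for the loop of docked robots. (b) If $state=explore$ and a robot $r$ is docked, or $r\ne i$ won the $\mathrm{MUTEX}$, then it waits for $(seen,parent\_ptr)=(visited[i],entry\_port[i])$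 from $r$; if $seen=0$ it sets $parent\_ptr\gets port\_entered$ and sends $port\_entered$ to $r$. If $seen=1$ and it did not just lose the $\mathrm{MUTEX}$, it sets $state\gets backtrack$ and moves through $port\_entered$; otherwise it sets $port\_entered\gets(port\_entered+1)\bmod\delta$, sets $state\gets backtrack$ if $port\_entered=parent\_ptr$, and moves through $port\_entered$. (c) If $state=backtrack$, it waits for $(seen,parent\_ptr)=(visited[i],entry\_port[i])$ from the docked robot, sets $port\_entered\gets(port\_entered+1)\bmod\delta$, sets $state\gets explore$ if $port\_entered\neq parent\_ptr$, and moves through $port\_entered$. A docked robot loops forever: for every other robot $j$ waiting at its node it sends $visited[j]$ and $entry\_port[j]$ to $j$, and if $visited[j]=0$ it sets $visited[j]\gets1$ and stores the $port\_entered$ received from $j$ in $entry\_port[j]$. **Theorem.** Algorithm Helping-Async achieves dispersion, without termination, in an asynchronous system, in $O(m)$ steps with $O(k\log\Delta)$ bits at each robot. Precisely: 1. In every execution, each robot, while undocked, executes at most $C\max(1,m)$ steps of its own (not counting the time in which it merely waits for a message) and makes at most $4m-2(n-1)$ moves along edges, where $C$ is an absolute constant. A docked robot stays docked at its node. If every robot,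 docked or not, takes infinitely many steps, then from some time on all robots are docked, at pairwise distinct nodes. 2. There is an absolute constant $C'$ such that, for all $k\ge1$ and $\Delta$, the label and the entire memory content of each robot, at any time of any execution with $k$ robots on any graph as above of maximum degree at most $\Delta$, can be encoded in $B$ bits for some $B\le C'\,k\max(1,\log_2\Delta)$, with a code that depends only on $k$ and $\Delta$. 3. Docked robots must stay active forever to help visiting robots: for every number $c$ there is an execution (on some graph as above, with some $k\le n$) in which a docked robot stops for good after at least $c$ further steps, all other robots take infinitely many steps, and yet some other robot stays undocked forever, waiting at the node of the stopped robot. -/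

import Mathlib

universe u

namespace HelpingAsync

/-- A port labelling of a graph: at every node `v`, the incident edges (i.e. the neighbours of `v`)
carry the labels `0, …, δ - 1`, where `δ` is the degree of `v`.  The two labels of an edge at its
two ends are unrelated. -/
structure PortLabeling {V : Type u} [Fintype V] [DecidableEq V] (G : SimpleGraph V)
    [DecidableRel G.Adj] where
  /-- the label, at `v`, of the edge from `v` to a neighbour -/
  port : (v : V) → G.neighborSet v ≃ Fin (G.degree v)

/-! ### The robots -/

/-- The variable `state` of a robot. -/
inductive RobotState
  | explore
  | backtrack
  | settled
deriving DecidableEq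

/-- The control point of a robot: where in the code of its current iteration it is.
* `start`: at the top of the main loop;
* `contend`: about to call `MUTEX(node)`, having seen that no robot is docked at the node;
* `await lost`: waiting for the message of the robot that docks at the node (`lost` says whether
  the robot has just lost `MUTEX(node)`);
* `act lost`: that message has been received; about to select a port and to move;
* `help`: in the endless loop of a docked robot. -/
inductive Phase
  | start
  | contend
  | await (lost : Bool)
  | act (lost : Bool)
  | help
deriving DecidableEq

/-- The complete memory of a robot (besides its label); ports range over `-1, 0, 1, …`, where `-1`
stands for no port.  The two arrays are only used from the moment on when the robot docks. -/
structure Memory (k : ℕ) where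
  phase : Phase
  state : RobotState
  portEntered : ℤ
  parentPtr : ℤ
  seen : Bool
  visited : Fin k → Bool
  entryPort : Fin k → ℤ

/-- The initial memory of every robot. -/
def Memory.init (k : ℕ) : Memory k where
  phase := .start
  state := .explore
  portEntered := -1
  parentPtr := -1
  seen := false
  visited := fun _ => false
  entryPort := fun _ => -1

/-- Where a robot is: at a node, with the port through which it came in (`none` in its first
iteration, before it has moved), or on an edge, on its way to a node that it is going to enter
through the given port. -/
inductive Place (V : Type u)
  | at (v : V) (entry : Option ℕ)
  | transit (v : V) (entry : ℕ)

/-- The node at which a robot is, if it is not on an edge. -/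
def Place.node? {V : Type u} : Place V → Option V
  | .at v _ => some v
  | .transit _ _ => none

/-- A configuration of the whole system of `k` robots, labelled by `Fin k`.  The component `lock`
is the state of the mutual exclusion primitive: `lock v` is the winner of `MUTEX(v)`, if there is
one already. -/
structure Config (V : Type u) (k : ℕ) where
  place : Fin k → Place V
  mem : Fin k → Memory k
  lock : V → Option (Fin k)

namespace Config

variable {V : Type u} {k : ℕ}

/-- Robot `i` is docked at node `v`. -/
abbrev DockedAt (c : Config V k) (i : Fin k) (v : V) : Prop :=
  (c.place i).node? = some v ∧ (c.mem i).state = .settled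

/-- Robot `i` contends for docking at node `v`. -/
abbrev ContendsAt (c : Config V k) (i : Fin k) (v : V) : Prop :=
  (c.place i).node? = some v ∧ (c.mem i).state ≠ .settled ∧ (c.mem i).phase = .contend

/-- Robot `i` is waiting (at a node) for the message of a docked robot. -/
abbrev Waits (c : Config V k) (i : Fin k) : Prop :=
  (c.mem i).phase = .await false ∨ (c.mem i).phase = .await true

/-- Robot `i` is waiting at node `v` for the message of the robot docked there. -/
abbrev WaitsAt (c : Config V k) (i : Fin k) (v : V) : Prop :=
  (c.place i).node? = some v ∧ (c.mem i).state ≠ .settled ∧ c.Waits i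

/-- Initially all robots are placed by `s`, and none has executed any code. -/
def init (s : Fin k → V) : Config V k where
  place := fun i => .at (s i) none
  mem := fun _ => Memory.init k
  lock := fun _ => none

end Config

section Algorithm

variable {V : Type u} [Fintype V] [DecidableEq V] {G : SimpleGraph V} [DecidableRel G.Adj] {k : ℕ}

/-- Where a robot at node `v` gets to when it moves through port `p`: onto the edge with this label
at `v`, towards the other end, which it will enter through the label of the edge there.
(If `v` has no port `p` then the robot stays where it is.) -/
def depart (L : PortLabeling G) (v : V) (entry : Option ℕ) (p : ℤ) : Place V :=
  if h : 0 ≤ p ∧ p.toNat < G.degree v then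
    let w := (L.port v).symm ⟨p.toNat, h.2⟩
    .transit w.1 (L.port w.1 ⟨v, w.2.symm⟩ : ℕ)
  else .at v entry

/-- Robot `i` is at the top of the main loop, at node `v`.  Except in its first iteration, it
records its entry port.  Then, if it backtracks or if a robot is docked at the node, it goes on to
communicate with the docked robot; otherwise it goes on to contend for the node. -/
def stepStart (i : Fin k) (v : V) (entry : Option ℕ) (c : Config V k) : Config V k :=
  let m : Memory k := c.mem i
  let m₁ : Memory k :=
    match entry with
    | none => m
    | some p => { m with portEntered := p, parentPtr := p, seen := false }
  let ph : Phase :=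
    if m.state = .backtrack ∨ ∃ j, c.DockedAt j v then .await false else .contend
  { c with mem := Function.update c.mem i { m₁ with phase := ph } }

/-- Robot `i` calls `MUTEX(v)`.  If there is no winner yet, then one of the contending robots is
selected (an arbitrary one: the robot `w` if that is contending for `v`, and otherwise robot `i`).
If robot `i` is the winner then it docks and initializes its two arrays.  Otherwise it goes on to
communicate with the winner. -/
def stepContend (i w : Fin k) (v : V) (c : Config V k) : Config V k :=
  let m : Memory k := c.mem i
  let r : Fin k :=
    match c.lock v with
    | some r => r
    | none => if c.ContendsAt w v then w else i
  let m' : Memory k :=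
    if r = i then
      { m with
        phase := .help
        state := .settled
        visited := fun _ => false
        entryPort := fun _ => -1 }
    else { m with phase := .await true }
  { c with mem := Function.update c.mem i m', lock := Function.update c.lock v (some r) }

/-- Robot `i`, at node `v`, has received the message of the docked robot and ends its iteration:
it selects the port through which to leave, updates `state`, and moves. -/
def stepAct (L : PortLabeling G) (i : Fin k) (v : V) (entry : Option ℕ) (lost : Bool)
    (c : Config V k) : Config V k :=
  let m : Memory k := c.mem i
  let next : ℤ := (m.portEntered + 1) % (G.degree v : ℤ)
  let m' : Memory k :=
    if m.state = .explore ∧ m.seen = true ∧ lost = false then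
      -- the node has been visited before: go back
      { m with phase := .start, state := .backtrack }
    else
      { m with
        phase := .start
        portEntered := next
        state := if next = m.parentPtr then .backtrack else .explore }
  { c with
    mem := Function.update c.mem i m'
    place := Function.update c.place i (depart L v entry m'.portEntered) }

/-- One pass of the endless loop of robot `j`, which is docked at node `v`: for every other robot
`i` that waits at the node, it sends `visited[i]` and `entry_port[i]` to `i`, and if `visited[i]`
is `0` then it sets `visited[i]` to `1` and receives `port_entered` from `i` as `entry_port[i]`.
On receipt, robot `i` sets `seen` and `parent_ptr` (where an exploring robot that is here for the
first time takes `port_entered` as its `parent_ptr`). -/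
def stepHelp (j : Fin k) (v : V) (c : Config V k) : Config V k :=
  let d : Memory k := c.mem j
  { c with
    mem := fun i =>
      let m : Memory k := c.mem i
      if i = j then
        { d with
          visited := fun x => d.visited x || decide (c.WaitsAt x v)
          entryPort := fun x =>
            if c.WaitsAt x v ∧ d.visited x = false then (c.mem x).portEntered
            else d.entryPort x }
      else if c.WaitsAt i v then
        { m with
          phase := if m.phase = .await true then .act true else .act false
          seen := d.visited i
          parentPtr :=
            if m.state = .explore ∧ d.visited i = false then m.portEntered else d.entryPort i }
      else m }

/-- One atomic step of robot `i` (the robot `w` is the choice of `MUTEX`, if it has one to make).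
A robot on an edge arrives at the end of the edge, a docked robot makes one pass of its endless
loop, and a robot that waits for the message of a docked robot just keeps waiting. -/
def step (L : PortLabeling G) (i w : Fin k) (c : Config V k) : Config V k :=
  match c.place i with
  | .transit v p => { c with place := Function.update c.place i (.at v (some p)) }
  | .at v entry =>
    if (c.mem i).state = .settled then stepHelp i v c
    else
      match (c.mem i).phase with
      | .start => stepStart i v entry c
      | .contend => stepContend i w v c
      | .await _ => c
      | .act lost => stepAct L i v entry lost c
      | .help => c

/-- The execution of the algorithm from the initial placement `s` of the robots, when the
asynchronous scheduler lets the robots `sched 0, sched 1, sched 2, …` take one step each, in this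
order, and `MUTEX` chooses according to `choice`. -/
def run (L : PortLabeling G) (s : Fin k → V) (sched choice : ℕ → Fin k) : ℕ → Config V k
  | 0 => Config.init s
  | t + 1 => step L (sched t) (choice t) (run L s sched choice t)

/-- The number of steps before time `t` in which robot `i` is active on its own behalf: it is not
docked yet, and it is not just waiting for a message. -/
def activeSteps (L : PortLabeling G) (s : Fin k → V) (sched choice : ℕ → Fin k)
    (i : Fin k) (t : ℕ) : ℕ :=
  ((Finset.range t).filter fun r =>
    sched r = i ∧ ((run L s sched choice r).mem i).state ≠ .settled ∧
      ¬ (run L s sched choice r).Waits i).card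

/-- The number of moves before time `t` of robot `i`: the steps of the robot that take it from a
node onto an edge. -/
def moves (L : PortLabeling G) (s : Fin k → V) (sched choice : ℕ → Fin k)
    (i : Fin k) (t : ℕ) : ℕ :=
  ((Finset.range t).filter fun r =>
    sched r = i ∧ ((run L s sched choice r).place i).node?.isSome = true ∧
      ((run L s sched choice (r + 1)).place i).node? = none).card

end Algorithm

/-- A robot takes infinitely many steps. -/
def ActiveForever {k : ℕ} (sched : ℕ → Fin k) (i : Fin k) : Prop :=
  ∀ t, ∃ t' ≥ t, sched t' = i

end HelpingAsync

set_option linter.unusedSectionVars false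

/-! The docked robots together store, separately for each robot `i`, which nodes `i` has visited and
the port to the parent of each. As long as a robot is undocked, what it does is therefore a
depth-first search of the whole graph, whatever the other robots do: asynchrony only delays it. The
proof splits this into an algorithm-free part and a simulation.

The algorithm-free part is the invariant `IsDfs` of a search history. Each exploration of a port
costs a move out, and later a move back: at once if the other end was seen before, otherwise when
the discovered node is closed. A node other than the root never explores its parent port, so the
explorations number at most `2m - (n - 1)`, and counting the moves gives the bound `4m - 2(n - 1)`
(`IsDfs.moves_le`). The search could go wrong only by continuing after all ports of the root are
used up. By then it has seen every node (`IsDfs.seen_eq_univ`), with a robot docked at each; since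
`k ≤ n`, every robot is then docked (`Helped.ne_univ`).

The simulation invariant `Track` matches each control point of an undocked robot with a search
history. It survives the robot's own steps (`Track.steps_self`), the message of a docked robot
(`Track.steps_help`) and all other steps (`Track.steps_of_ne`). At most four active steps go with
each move, so active steps are bounded too, and a robot that never docks must wait forever from some
time on. But a waiting robot always has another robot as the winner of `MUTEX` at its node
(`Track.waits`); that robot docks when it is next active and then answers, a contradiction
(`exists_settled`).

For memory, every stored port lies between `-1` and `Δ - 1`, so the possible memories form an
explicit finite type whose cardinality is estimated. Necessity of help is shown on one edge: a robot
docks, idles for `c` steps and stops, and only then does its companion look at the node. -/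

namespace HelpingAsync

/-! ### Ports as integers, with `-1` for no port -/

section Ports

variable {V : Type u} [Fintype V] [DecidableEq V] {G : SimpleGraph V} [DecidableRel G.Adj]

/-- The label at `v` of the edge to `w`, and `-1` if there is no such edge. -/
def portTo (L : PortLabeling G) (v w : V) : ℤ :=
  if h : G.Adj v w then ((L.port v ⟨w, h⟩ : ℕ) : ℤ) else -1

/-- The other end of the edge with label `p` at `v`, and `v` itself if there is no such edge. -/
def nbr (L : PortLabeling G) (v : V) (p : ℤ) : V :=
  if h : p.toNat < G.degree v then ((L.port v).symm ⟨p.toNat, h⟩).1 else v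

variable {L : PortLabeling G} {v w : V} {p : ℤ}

theorem portTo_self : portTo L v v = -1 := by simp [portTo]

theorem portTo_nonneg (h : G.Adj v w) : 0 ≤ portTo L v w := by simp [portTo, h]

theorem portTo_lt (h : G.Adj v w) : portTo L v w < G.degree v := by simp [portTo, h]

theorem nbr_portTo (h : G.Adj v w) : nbr L v (portTo L v w) = w := by
  simp [portTo, nbr, h]

theorem adj_nbr (h : 0 ≤ p) (h' : p < G.degree v) : G.Adj v (nbr L v p) := by
  have h2 : p.toNat < G.degree v := by omega
  simp only [nbr, h2, dif_pos]
  exact ((L.port v).symm ⟨p.toNat, h2⟩).2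

theorem portTo_nbr (h : 0 ≤ p) (h' : p < G.degree v) : portTo L v (nbr L v p) = p := by
  have h2 : p.toNat < G.degree v := by omega
  have h3 := adj_nbr (L := L) h h'
  simp only [portTo, h3, dif_pos]
  simp only [nbr, h2, dif_pos, Subtype.coe_eta, Equiv.apply_symm_apply]
  omega

theorem portTo_injective {w' : V} (h : G.Adj v w) (h' : G.Adj v w')
    (e : portTo L v w = portTo L v w') : w = w' := by
  rw [← nbr_portTo (L := L) h, e, nbr_portTo h']

theorem depart_eq (entry : Option ℕ) (h : 0 ≤ p) (h' : p < G.degree v) :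
    depart L v entry p = .transit (nbr L v p) (portTo L (nbr L v p) v).toNat := by
  have h2 : p.toNat < G.degree v := by omega
  have h3 : G.Adj v ((L.port v).symm ⟨p.toNat, h2⟩).1 := ((L.port v).symm ⟨p.toNat, h2⟩).2
  have h4 : nbr L v p = ((L.port v).symm ⟨p.toNat, h2⟩).1 := dif_pos h2
  rw [h4]
  simp [depart, portTo, h, h2, h3.symm]

theorem depart_of_lt (entry : Option ℕ) {u : V} {e : ℕ} (h : depart L v entry p = .transit u e) :
    e < G.degree u := by
  unfold depart at h
  split_ifs at h
  simp only [Place.transit.injEq] at h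
  obtain ⟨rfl, rfl⟩ := h
  exact Fin.is_lt _

end Ports

/-! ### Depth-first search, independently of the algorithm -/

section DepthFirstSearch

/-- The history of a depth-first search: the nodes seen so far, those among them that have been left
towards their parents, the parent of every node (the root is its own parent), the number of ports
of every node that have been explored, the depth in the search tree, the root, and the end of the
current path in the search tree. -/
structure Trace (V : Type u) where
  seen : Finset V
  closed : Finset V
  parent : V → V
  off : V → ℕ
  depth : V → ℕ
  root : V
  top : V

variable {V : Type u} [Fintype V] [DecidableEq V] {G : SimpleGraph V} [DecidableRel G.Adj]

/-- The port of `v` explored as the `j`-th one: the ports are explored in cyclic order, from the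
one to the parent on. -/
def Trace.nthPort (L : PortLabeling G) (D : Trace V) (v : V) (j : ℕ) : ℤ :=
  (portTo L v (D.parent v) + j) % (G.degree v : ℤ)

/-- `D` is the history of a depth-first search after `m` moves.  Here `pend` is `1` if the search is
just exploring an edge, so that its other end need not have been seen, and `0` otherwise. -/
structure IsDfs (L : PortLabeling G) (m pend : ℕ) (D : Trace V) : Prop where
  root_mem : D.root ∈ D.seen
  top_mem : D.top ∈ D.seen
  top_open : D.top ∉ D.closed
  root_open : D.root ∉ D.closed
  closed_subset : D.closed ⊆ D.seen
  parent_root : D.parent D.root = D.root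
  adj_parent : ∀ v ∈ D.seen, v ≠ D.root → G.Adj v (D.parent v)
  parent_mem : ∀ v ∈ D.seen, v ≠ D.root → D.parent v ∈ D.seen
  depth_parent : ∀ v ∈ D.seen, v ≠ D.root → D.depth (D.parent v) < D.depth v
  off_lt : ∀ v ∈ D.seen, v ≠ D.root → D.off v + 1 ≤ G.degree v
  off_root : D.off D.root ≤ G.degree D.root
  off_eq_zero : ∀ v ∉ D.seen, D.off v = 0
  off_closed : ∀ v ∈ D.closed, D.off v + 1 = G.degree v
  -- This condition and the next two make the open nodes the tree path from `root` to `top`: parents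
  -- of open nodes are open, `top` has no open child, and an open child hangs at the port its parent
  -- explored last.
  open_parent : ∀ v ∈ D.seen, v ≠ D.root → v ∉ D.closed → D.parent v ∉ D.closed
  open_ne_top : ∀ v ∈ D.seen, v ≠ D.root → v ∉ D.closed → D.parent v ≠ D.top
  open_port : ∀ v ∈ D.seen, v ≠ D.root → v ∉ D.closed →
    portTo L (D.parent v) v = D.nthPort L (D.parent v) (D.off (D.parent v))
  explored : ∀ v ∈ D.seen, ∀ j, 1 ≤ j → j + (if v = D.top then pend else 0) ≤ D.off v →
    nbr L v (D.nthPort L v j) ∈ D.seen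
  -- Of the `∑ off` moves out, `seen.card - 1` discovered a node and `pend` are unresolved; each of
  -- the others was followed by a move straight back. The remaining moves are the `closed.card`
  -- moves to parents.
  count : m + pend + D.seen.card = 2 * ∑ v, D.off v + D.closed.card + 1

variable {L : PortLabeling G} {m : ℕ} {D : Trace V}

/-- The number of moves of a depth-first search. -/
theorem IsDfs.moves_le {pend : ℕ} (h : IsDfs L m pend D) (hG : G.Connected) :
    m + 2 * (Fintype.card V - 1) ≤ 4 * G.edgeFinset.card := by
  have hpos : 0 < Fintype.card V := Fintype.card_pos_iff.2 ⟨D.root⟩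
  have h1 : D.closed.card + 1 ≤ D.seen.card := by
    rw [← Finset.card_insert_of_notMem h.root_open]
    exact Finset.card_le_card (Finset.insert_subset h.root_mem h.closed_subset)
  -- Only the root may use all its ports. An unseen node has `off` zero and, by connectedness,
  -- positive degree.
  have h2 : ∀ v, D.off v + 1 ≤ G.degree v + if v = D.root then 1 else 0 := by
    intro v
    split_ifs with hv
    · subst hv; have := h.off_root; omega
    · by_cases hs : v ∈ D.seen
      · exact h.off_lt v hs hv
      · rw [h.off_eq_zero v hs]
        have : Nontrivial V := ⟨v, D.root, hv⟩
        exact hG.preconnected.degree_pos_of_nontrivial v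
  have h3 := Finset.sum_le_sum fun v (_ : v ∈ Finset.univ) => h2 v
  simp only [Finset.sum_add_distrib, Finset.sum_ite_eq', Finset.mem_univ, if_true,
    G.sum_degrees_eq_twice_card_edges, Finset.sum_const, Finset.card_univ, smul_eq_mul,
    mul_one] at h3
  have h4 := h.count
  omega

/-- The start of a depth-first search. -/
theorem isDfs_init (L : PortLabeling G) (r : V) :
    IsDfs L 0 0 ⟨{r}, ∅, fun _ => r, fun _ => 0, fun _ => 0, r, r⟩ := by
  constructor <;> simp +contextual
  intro j h1 h2; omega

/-- When all ports of the root have been explored, all nodes have been seen. -/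
theorem IsDfs.seen_eq_univ (h : IsDfs L m 0 D) (hG : G.Connected) (ht : D.top = D.root)
    (ho : D.off D.root = G.degree D.root) : D.seen = Finset.univ := by
  -- With `top` at the root, an open node `v` other than the root would have an open parent that is
  -- again not the root, at smaller depth.
  have hcl : ∀ n, ∀ v ∈ D.seen, v ≠ D.root → D.depth v = n → v ∈ D.closed := by
    intro n
    induction n using Nat.strong_induction_on with
    | _ n ih =>
      intro v hv hr hn
      by_contra hc
      have h1 := h.open_ne_top v hv hr hc
      rw [ht] at h1
      exact h.open_parent v hv hr hc
        (ih _ (hn ▸ h.depth_parent v hv hr) _ (h.parent_mem v hv hr) h1 rfl)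
  have hadj : ∀ v ∈ D.seen, ∀ y, G.Adj v y → y ∈ D.seen := by
    intro v hv y hy
    have hq0 := portTo_nonneg (L := L) hy
    have hq1 := portTo_lt (L := L) hy
    have key : ∀ j : ℕ, 1 ≤ j → j ≤ D.off v → D.nthPort L v j = portTo L v y → y ∈ D.seen := by
      intro j h1 h2 h3
      have := h.explored v hv j h1 (by simpa using h2)
      rwa [h3, nbr_portTo hy] at this
    by_cases hr : v = D.root
    · refine key (portTo L v y + 1).toNat (by omega) (by rw [hr, ho, ← hr]; omega) ?_
      have h0 : D.parent v = v := by rw [hr, h.parent_root]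
      rw [Trace.nthPort, h0, portTo_self, Int.toNat_of_nonneg (by omega)]
      rw [show (-1 + (portTo L v y + 1) : ℤ) = portTo L v y by ring]
      exact Int.emod_eq_of_lt hq0 hq1
    · have ho' := h.off_closed v (hcl _ v hv hr rfl)
      have hp := h.adj_parent v hv hr
      have hp0 := portTo_nonneg (L := L) hp
      have hp1 := portTo_lt (L := L) hp
      rcases lt_trichotomy (portTo L v y) (portTo L v (D.parent v)) with hlt | heq | hgt
      · refine key (portTo L v y - portTo L v (D.parent v) + G.degree v).toNat
          (by omega) (by omega) ?_
        rw [Trace.nthPort, Int.toNat_of_nonneg (by omega)]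
        rw [show (portTo L v (D.parent v) + (portTo L v y - portTo L v (D.parent v) + G.degree v)
          : ℤ) = portTo L v y + G.degree v by ring, Int.add_emod_right]
        exact Int.emod_eq_of_lt hq0 hq1
      · rw [portTo_injective hy hp heq]
        exact h.parent_mem v hv hr
      · refine key (portTo L v y - portTo L v (D.parent v)).toNat (by omega) (by omega) ?_
        rw [Trace.nthPort, Int.toNat_of_nonneg (by omega)]
        rw [add_sub_cancel]
        exact Int.emod_eq_of_lt hq0 hq1
  ext y
  simp only [Finset.mem_univ, iff_true]
  obtain ⟨p⟩ := hG.preconnected D.root y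
  have : ∀ {a b : V}, G.Walk a b → a ∈ D.seen → b ∈ D.seen := by
    intro a b p
    induction p with
    | nil => exact id
    | cons hab _ ih => exact fun ha => ih (hadj _ ha _ hab)
  exact this p h.root_mem

/-- The port that is explored next at the end of the current path. -/
def Trace.next (L : PortLabeling G) (D : Trace V) : ℤ :=
  D.nthPort L D.top (D.off D.top + 1)

theorem Trace.nthPort_nonneg {v : V} (hd : 0 < G.degree v) (j : ℕ) : 0 ≤ D.nthPort L v j :=
  Int.emod_nonneg _ (by omega)

theorem Trace.nthPort_lt {v : V} (hd : 0 < G.degree v) (j : ℕ) :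
    D.nthPort L v j < G.degree v :=
  Int.emod_lt_of_pos _ (by omega)

/-- The search leaves the end of the current path towards its parent. -/
def Trace.close (D : Trace V) : Trace V :=
  { D with closed := insert D.top D.closed, top := D.parent D.top }

/-- The search explores another port at the end of the current path. -/
def Trace.explore (D : Trace V) : Trace V :=
  { D with off := Function.update D.off D.top (D.off D.top + 1) }

/-- The search extends the current path to the node `w`. -/
def Trace.extend (D : Trace V) (w : V) : Trace V :=
  { D with
    seen := insert w D.seen
    parent := Function.update D.parent w D.top
    depth := Function.update D.depth w (D.depth D.top + 1)
    top := w }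

/-- The parent port of the root is `-1`, which is never a remainder modulo the degree; so the search
never tries to leave the root towards a parent. -/
theorem IsDfs.top_ne_root (h : IsDfs L m 0 D) (hd : 0 < G.degree D.top)
    (hn : D.next L = portTo L D.top (D.parent D.top)) : D.top ≠ D.root := by
  intro hr
  have h1 := Trace.nthPort_nonneg (L := L) (D := D) hd (D.off D.top + 1)
  unfold Trace.next at hn
  rw [hn, hr, h.parent_root, portTo_self] at h1
  omega

theorem IsDfs.close (h : IsDfs L m 0 D) (hd : 0 < G.degree D.top)
    (hn : D.next L = portTo L D.top (D.parent D.top)) :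
    IsDfs L (m + 1) 0 D.close := by
  have hr := h.top_ne_root hd hn
  have hx := h.top_mem
  have hne : D.parent D.top ≠ D.top := (h.adj_parent _ hx hr).ne'
  constructor <;> simp only [Trace.close]
  · exact h.root_mem
  · exact h.parent_mem _ hx hr
  · simp [hne, h.open_parent _ hx hr h.top_open]
  · simp [hr.symm, h.root_open]
  · exact Finset.insert_subset hx h.closed_subset
  · exact h.parent_root
  · exact h.adj_parent
  · exact h.parent_mem
  · exact h.depth_parent
  · exact h.off_lt
  · exact h.off_root
  · exact h.off_eq_zero
  · intro v hv
    rcases Finset.mem_insert.1 hv with rfl | hv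
    · have hp := h.adj_parent _ hx hr
      have hp0 := portTo_nonneg (L := L) hp
      have hp1 := portTo_lt (L := L) hp
      have ho := h.off_lt _ hx hr
      -- The cyclic order returns to the parent port only after a full turn, that is, when `off + 1`
      -- equals the degree.
      by_contra hlt
      unfold Trace.next Trace.nthPort at hn
      rcases lt_or_ge (portTo L D.top (D.parent D.top) + ((D.off D.top + 1 : ℕ) : ℤ))
        (G.degree D.top) with hc | hc
      · rw [Int.emod_eq_of_lt (by omega) hc] at hn
        omega
      · rw [← Int.sub_emod_right, Int.emod_eq_of_lt (by omega) (by omega)] at hn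
        omega
    · exact h.off_closed v hv
  · intro v hv hvr hc
    simp only [Finset.mem_insert, not_or] at hc ⊢
    exact ⟨h.open_ne_top v hv hvr hc.2, h.open_parent v hv hvr hc.2⟩
  · intro v hv hvr hc he
    simp only [Finset.mem_insert, not_or] at hc
    -- Another open child of the new `top` would hang at the same last explored port as the node
    -- just closed.
    have h1 := h.open_port v hv hvr hc.2
    rw [he, ← h.open_port _ hx hr h.top_open] at h1
    refine hc.1 (portTo_injective ?_ (h.adj_parent _ hx hr).symm h1)
    rw [← he]
    exact (h.adj_parent v hv hvr).symm
  · intro v hv hvr hc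
    simp only [Finset.mem_insert, not_or] at hc
    exact h.open_port v hv hvr hc.2
  · intro v hv j h1 h2
    exact h.explored v hv j h1 (by split_ifs <;> exact (Nat.le_add_right _ _).trans h2)
  · have := h.count
    rw [Finset.card_insert_of_notMem h.top_open]
    omega

/-- The next port is really unexplored. Away from the root, exhausting the other ports would make
the parent port the next one, against `hn`; at the root it would mean that every node has been seen,
against `hu`. -/
theorem IsDfs.explore (h : IsDfs L m 0 D) (hG : G.Connected) (hu : D.seen ≠ Finset.univ)
    (hn : D.next L ≠ portTo L D.top (D.parent D.top)) :
    IsDfs L (m + 1) 1 D.explore := by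
  have hx := h.top_mem
  have hoff : ∀ v, v ≠ D.top → Function.update D.off D.top (D.off D.top + 1) v = D.off v :=
    fun v hv => Function.update_of_ne hv _ _
  constructor <;> simp only [Trace.explore]
  · exact h.root_mem
  · exact hx
  · exact h.top_open
  · exact h.root_open
  · exact h.closed_subset
  · exact h.parent_root
  · exact h.adj_parent
  · exact h.parent_mem
  · exact h.depth_parent
  · intro v hv hr
    by_cases hvt : v = D.top
    · subst hvt
      rw [Function.update_self]
      have h1 := h.off_lt _ hv hr
      by_contra hlt
      have h2 : ((D.off D.top + 1 : ℕ) : ℤ) = G.degree D.top := by omega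
      apply hn
      have hp := h.adj_parent _ hx hr
      unfold Trace.next Trace.nthPort
      rw [h2, Int.add_emod_right]
      exact Int.emod_eq_of_lt (portTo_nonneg hp) (portTo_lt hp)
    · rw [hoff v hvt]
      exact h.off_lt v hv hr
  · by_cases hvt : D.root = D.top
    · have h0 : Function.update D.off D.top (D.off D.top + 1) D.root = D.off D.root + 1 := by
        rw [hvt, Function.update_self]
      refine h0.trans_le ?_
      have h1 := h.off_root
      have h2 : D.off D.root ≠ G.degree D.root := fun h2 =>
        hu (h.seen_eq_univ hG hvt.symm h2)
      exact lt_of_le_of_ne h1 h2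
    · exact (hoff _ hvt).trans_le h.off_root
  · intro v hv
    rw [hoff v (fun e => hv (e ▸ hx))]
    exact h.off_eq_zero v hv
  · intro v hv
    rw [hoff v (fun e => h.top_open (e ▸ hv))]
    exact h.off_closed v hv
  · exact h.open_parent
  · exact h.open_ne_top
  · intro v hv hr hc
    rw [hoff _ (h.open_ne_top v hv hr hc)]
    exact h.open_port v hv hr hc
  · intro v hv j h1 h2
    refine h.explored v hv j h1 ?_
    by_cases hvt : v = D.top
    · subst hvt
      simpa using h2
    · simpa [hoff v hvt, hvt] using h2
  · have := h.count
    have h1 := Finset.sum_update_of_mem (Finset.mem_univ D.top) D.off (D.off D.top + 1)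
    have h2 := Finset.sum_update_of_mem (Finset.mem_univ D.top) D.off (D.off D.top)
    rw [Function.update_eq_self] at h2
    omega

/-- The other end is an old node, and in `count` the move straight back replaces the pending unit.
-/
theorem IsDfs.return (h : IsDfs L m 1 D)
    (hw : nbr L D.top (D.nthPort L D.top (D.off D.top)) ∈ D.seen) : IsDfs L (m + 1) 0 D :=
  { h with
    explored := by
      intro v hv j h1 h2
      by_cases hj : v = D.top ∧ j = D.off v
      · obtain ⟨rfl, rfl⟩ := hj
        exact hw
      · refine h.explored v hv j h1 ?_
        split_ifs at h2 ⊢ <;> simp_all; omega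
    count := by
      have := h.count
      omega }

/-- Here the new element of `seen` replaces the pending unit, without a move: the way back along
this edge is counted when `w` is closed. -/
theorem IsDfs.extend (h : IsDfs L m 1 D) (hd : 0 < G.degree D.top) {w : V}
    (hw : w = nbr L D.top (D.nthPort L D.top (D.off D.top))) (hws : w ∉ D.seen) :
    IsDfs L m 0 (D.extend w) := by
  have hx := h.top_mem
  have hne : ∀ v ∈ D.seen, v ≠ w := fun v hv e => hws (e ▸ hv)
  have hpar : ∀ v ∈ D.seen, Function.update D.parent w D.top v = D.parent v :=
    fun v hv => Function.update_of_ne (hne v hv) _ _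
  have hdep : ∀ v ∈ D.seen, Function.update D.depth w (D.depth D.top + 1) v = D.depth v :=
    fun v hv => Function.update_of_ne (hne v hv) _ _
  have hnth : ∀ v ∈ D.seen, ∀ j, (D.extend w).nthPort L v j = D.nthPort L v j := by
    intro v hv j
    simp only [Trace.nthPort, Trace.extend, hpar v hv]
  have h0 := Trace.nthPort_nonneg (L := L) (D := D) hd (D.off D.top)
  have h1 := Trace.nthPort_lt (L := L) (D := D) hd (D.off D.top)
  have hadj : G.Adj D.top w := hw ▸ adj_nbr h0 h1
  have hport : portTo L D.top w = D.nthPort L D.top (D.off D.top) := by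
    rw [hw]; exact portTo_nbr h0 h1
  have hroot := h.root_mem
  have hwr : w ≠ D.root := (hne _ hroot).symm
  constructor
  · exact Finset.mem_insert_of_mem hroot
  · exact Finset.mem_insert_self _ _
  · exact fun hc => hws (h.closed_subset hc)
  · exact h.root_open
  · exact h.closed_subset.trans (Finset.subset_insert _ _)
  · exact (hpar _ hroot).trans h.parent_root
  · intro v hv hr
    rcases Finset.mem_insert.1 hv with rfl | hv
    · simpa [Trace.extend] using hadj.symm
    · simpa [Trace.extend, hpar v hv] using h.adj_parent v hv hr
  · intro v hv hr
    rcases Finset.mem_insert.1 hv with rfl | hv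
    · simp [Trace.extend, hx]
    · simp [Trace.extend, hpar v hv, h.parent_mem v hv hr]
  · intro v hv hr
    rcases Finset.mem_insert.1 hv with rfl | hv
    · simp [Trace.extend, hdep _ hx]
    · simp only [Trace.extend, hpar v hv, hdep v hv, hdep _ (h.parent_mem v hv hr)]
      exact h.depth_parent v hv hr
  · intro v hv hr
    rcases Finset.mem_insert.1 hv with rfl | hv
    · simp only [Trace.extend, h.off_eq_zero _ hws]
      exact (G.degree_pos_iff_exists_adj _).2 ⟨_, hadj.symm⟩
    · exact h.off_lt v hv hr
  · exact h.off_root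
  · exact fun v hv => h.off_eq_zero v fun hv' => hv (Finset.mem_insert_of_mem hv')
  · exact h.off_closed
  · intro v hv hr hc
    rcases Finset.mem_insert.1 hv with rfl | hv
    · simpa [Trace.extend] using h.top_open
    · simpa [Trace.extend, hpar v hv] using h.open_parent v hv hr hc
  · intro v hv hr hc
    rcases Finset.mem_insert.1 hv with rfl | hv
    · simpa [Trace.extend] using hne _ hx
    · simpa [Trace.extend, hpar v hv] using hne _ (h.parent_mem v hv hr)
  · intro v hv hr hc
    rcases Finset.mem_insert.1 hv with rfl | hv
    · have hp : (D.extend v).parent v = D.top := by simp [Trace.extend]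
      rw [hp, hnth _ hx]
      exact hport
    · have hp : (D.extend w).parent v = D.parent v := hpar v hv
      rw [hp, hnth _ (h.parent_mem v hv hr)]
      exact h.open_port v hv hr hc
  · intro v hv j hj1 hj2
    rcases Finset.mem_insert.1 hv with rfl | hv
    · have : D.off v = 0 := h.off_eq_zero _ hws
      simp only [Trace.extend, this] at hj2
      omega
    · rw [hnth v hv]
      by_cases hj : v = D.top ∧ j = D.off v
      · obtain ⟨rfl, rfl⟩ := hj
        rw [← hw]
        exact Finset.mem_insert_self _ _
      · refine Finset.mem_insert_of_mem (h.explored v hv j hj1 ?_)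
        simp only [Trace.extend] at hj2
        split_ifs at hj2 ⊢ <;> simp_all; omega
  · have := h.count
    simp only [Trace.extend, Finset.card_insert_of_notMem hws]
    omega

end DepthFirstSearch

/-! ### Atomic steps and the consistency of docking with `MUTEX` -/

section Steps

variable {V : Type u} [Fintype V] [DecidableEq V] {G : SimpleGraph V} [DecidableRel G.Adj] {k : ℕ}

/-- The possible effects of a step of robot `i`. -/
inductive Steps (L : PortLabeling G) (i : Fin k) (c : Config V k) : Config V k → Prop
  | arrive (v : V) (p : ℕ) (hp : c.place i = .transit v p) :
      Steps L i c { c with place := Function.update c.place i (.at v (some p)) }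
  | help (v : V) (e : Option ℕ) (hp : c.place i = .at v e) (hs : (c.mem i).state = .settled) :
      Steps L i c (stepHelp i v c)
  | start (v : V) (e : Option ℕ) (hp : c.place i = .at v e) (hs : (c.mem i).state ≠ .settled)
      (hph : (c.mem i).phase = .start) : Steps L i c (stepStart i v e c)
  | dock (v : V) (e : Option ℕ) (hp : c.place i = .at v e) (hs : (c.mem i).state ≠ .settled)
      (hph : (c.mem i).phase = .contend) (hl : c.lock v = none ∨ c.lock v = some i) :
      Steps L i c { c with
        mem := Function.update c.mem i { c.mem i with
          phase := .help
          state := .settled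
          visited := fun _ => false
          entryPort := fun _ => -1 }
        lock := Function.update c.lock v (some i) }
  | lose (v : V) (e : Option ℕ) (hp : c.place i = .at v e) (hs : (c.mem i).state ≠ .settled)
      (hph : (c.mem i).phase = .contend) (r : Fin k) (hr : r ≠ i)
      (hl : c.lock v = some r ∨ c.lock v = none ∧ c.ContendsAt r v) :
      Steps L i c { c with
        mem := Function.update c.mem i { c.mem i with phase := .await true }
        lock := Function.update c.lock v (some r) }
  | act (v : V) (e : Option ℕ) (lost : Bool) (hp : c.place i = .at v e)
      (hs : (c.mem i).state ≠ .settled) (hph : (c.mem i).phase = .act lost) :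
      Steps L i c (stepAct L i v e lost c)
  | idle (v : V) (e : Option ℕ) (hp : c.place i = .at v e) (hs : (c.mem i).state ≠ .settled)
      (hph : c.Waits i ∨ (c.mem i).phase = .help) : Steps L i c c

theorem steps_step (L : PortLabeling G) (i w : Fin k) (c : Config V k) :
    Steps L i c (step L i w c) := by
  unfold step
  split
  · next v p hp => exact .arrive v p hp
  · next v e hp =>
    split_ifs with hs
    · exact .help v e hp hs
    · split
      · next hph => exact .start v e hp hs hph
      · next hph =>
        unfold stepContend
        cases hl : c.lock v with
        | some r =>
          by_cases hr : r = i
          · subst hr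
            simpa using Steps.dock (L := L) v e hp hs hph (.inr hl)
          · simpa [hr] using Steps.lose (L := L) v e hp hs hph r hr (.inl hl)
        | none =>
          by_cases hw : c.ContendsAt w v ∧ w ≠ i
          · have h1 : (if c.ContendsAt w v then w else i) = w := if_pos hw.1
            simpa only [h1, hw.2, if_false] using
              Steps.lose (L := L) v e hp hs hph w hw.2 (.inr ⟨hl, hw.1⟩)
          · have h1 : (if c.ContendsAt w v then w else i) = i := by
              split_ifs with h
              · by_contra h'
                exact hw ⟨h, h'⟩
              · rfl
            simpa only [h1, if_true] using Steps.dock (L := L) v e hp hs hph (.inl hl)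
      · next b hph =>
        refine .idle v e hp hs (.inl ?_)
        cases b
        · exact .inl hph
        · exact .inr hph
      · next lost hph => exact .act v e lost hp hs hph
      · next hph => exact .idle v e hp hs (.inr hph)

/-- The consistency of the docked robots with the mutual exclusion primitive. -/
structure Config.Sound (c : Config V k) : Prop where
  settled_iff : ∀ i, (c.mem i).state = .settled ↔ (c.mem i).phase = .help
  transit_start : ∀ i v p, c.place i = .transit v p → (c.mem i).phase = .start
  lock_of_docked : ∀ i v, c.DockedAt i v → c.lock v = some i
  lock_spec : ∀ i v, c.lock v = some i → (c.place i).node? = some v ∧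
    ((c.mem i).phase = .help ∨ (c.mem i).phase = .contend)

theorem sound_init (s : Fin k → V) : (Config.init s).Sound := by
  constructor <;> simp [Config.init, Memory.init]

variable {L : PortLabeling G} {c c' : Config V k} {i j : Fin k} {v : V}

theorem Place.node?_eq_some {P : Place V} : P.node? = some v ↔ ∃ e, P = .at v e := by
  cases P <;> simp [Place.node?]

theorem stepHelp_state (l : Fin k) : ((stepHelp j v c).mem l).state = (c.mem l).state := by
  simp only [stepHelp]
  split_ifs with h
  · rw [h]
  all_goals rfl

theorem stepHelp_phase (hs : (c.mem j).state = .settled) (l : Fin k) :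
    ((stepHelp j v c).mem l).phase = if c.WaitsAt l v then
      (if (c.mem l).phase = .await true then .act true else .act false) else (c.mem l).phase := by
  simp only [stepHelp]
  by_cases h : l = j
  · subst h
    simp [hs]
  · split_ifs <;> rfl

/-- A winner of `MUTEX` is docked or still contending at the node. It leaves the contending phase
only by calling `MUTEX` itself, which returns it, so that it docks there. -/
theorem Config.Sound.steps (h : c.Sound) (hst : Steps L j c c') : c'.Sound := by
  obtain ⟨h1, h2, h3, h4⟩ := h
  cases hst with
  | idle => exact ⟨h1, h2, h3, h4⟩
  | arrive v p hp =>
    have := h2 j v p hp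
    constructor <;> simp only [Function.update_apply, Config.DockedAt] at * <;> grind [Place.node?]
  | help v e hp hs =>
    constructor
    · intro i
      rw [stepHelp_state, stepHelp_phase hs]
      grind
    · intro i v' p hp'
      rw [stepHelp_phase hs]
      have : c.place i = .transit v' p := hp'
      grind
    · intro i v' hd
      rw [Config.DockedAt, stepHelp_state] at hd
      exact h3 i v' hd
    · intro i v' hd
      rw [stepHelp_phase hs]
      have := h4 i v' hd
      grind [stepHelp]
  | start v e hp hs hph =>
    constructor <;> simp only [stepStart, Function.update_apply, Config.DockedAt] at * <;>
      grind
  | dock v e hp hs hph hl =>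
    constructor <;> simp only [Function.update_apply, Config.DockedAt] at * <;> grind [Place.node?]
  | lose v e hp hs hph r hr hl =>
    constructor <;> simp only [Function.update_apply, Config.DockedAt, Config.ContendsAt] at * <;>
      grind [Place.node?]
  | act v e lost hp hs hph =>
    constructor <;> simp only [stepAct, Function.update_apply, Config.DockedAt] at * <;>
      grind [Place.node?]

theorem Config.Sound.docked_unique (h : c.Sound) {v : V} (hi : c.DockedAt i v)
    (hj : c.DockedAt j v) : i = j := by
  have h1 := h.lock_of_docked i v hi
  rw [h.lock_of_docked j v hj] at h1
  exact (Option.some.inj h1).symm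

theorem Config.DockedAt.steps (h : c.DockedAt i v) (hst : Steps L j c c') : c'.DockedAt i v := by
  cases hst with
  | idle => exact h
  | help v' e hp hs => rw [Config.DockedAt, stepHelp_state]; exact h
  | arrive v' p hp =>
    simp only [Function.update_apply, Config.DockedAt] at *
    grind [Place.node?]
  | start v' e hp hs hph =>
    simp only [stepStart, Function.update_apply, Config.DockedAt] at *
    grind
  | dock v' e hp hs hph hl =>
    simp only [Function.update_apply, Config.DockedAt] at *
    grind
  | lose v' e hp hs hph r hr hl =>
    simp only [Function.update_apply, Config.DockedAt] at *
    grind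
  | act v' e lost hp hs hph =>
    simp only [stepAct, Function.update_apply, Config.DockedAt] at *
    grind

theorem lock_steps (h : c.lock v = some i) (hst : Steps L j c c') : c'.lock v = some i := by
  cases hst with
  | dock | lose => simp only [Function.update_apply]; grind
  | _ => exact h

end Steps

/-! ### Persistence along executions -/

section Run

variable {V : Type u} [Fintype V] [DecidableEq V] {G : SimpleGraph V} [DecidableRel G.Adj] {k : ℕ}
variable {L : PortLabeling G} {s : Fin k → V} {sched choice : ℕ → Fin k}

theorem steps_run (t : ℕ) : Steps L (sched t) (run L s sched choice t)
    (run L s sched choice (t + 1)) := steps_step _ _ _ _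

theorem sound_run (t : ℕ) : (run L s sched choice t).Sound := by
  induction t with
  | zero => exact sound_init s
  | succ t ih => exact ih.steps (steps_run t)

theorem docked_run {i : Fin k} {v : V} {t t' : ℕ} (ht : t ≤ t')
    (h : (run L s sched choice t).DockedAt i v) : (run L s sched choice t').DockedAt i v := by
  induction t', ht using Nat.le_induction with
  | base => exact h
  | succ t' _ ih => exact ih.steps (steps_run t')

theorem lock_run {i : Fin k} {v : V} {t t' : ℕ} (ht : t ≤ t')
    (h : (run L s sched choice t).lock v = some i) : (run L s sched choice t').lock v = some i := by
  induction t', ht using Nat.le_induction with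
  | base => exact h
  | succ t' _ ih => exact lock_steps ih (steps_run t')

end Run

/-! ### The simulation invariant -/

section Tracking

variable {V : Type u} [Fintype V] [DecidableEq V] {G : SimpleGraph V} [DecidableRel G.Adj] {k : ℕ}

/-- The docked robots hold the data of the depth-first search of robot `i`: a robot is docked at
every node of `S`, and for robot `i` the docked robots have stored that exactly the nodes of `S`
have been visited, with `par` as the ports to the parents. -/
structure Helped (c : Config V k) (i : Fin k) (S : Finset V) (par : V → ℤ) : Prop where
  docked : ∀ v ∈ S, ∃ j, c.DockedAt j v
  visited : ∀ j v, c.DockedAt j v → (c.mem j).visited i = decide (v ∈ S)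
  entryPort : ∀ j v, c.DockedAt j v → v ∈ S → (c.mem j).entryPort i = par v

/-- Robot `i` moves to node `u`, or is there and has not yet received a message.  Here `S` is the
set of the nodes that it has visited before, and `entry` is the port through which it enters. -/
def Arriving (c : Config V k) (i : Fin k) (S : Finset V) (u : V) (entry : Option ℕ) : Prop :=
  (∃ e, entry = some e ∧ c.place i = .transit u e ∧ (c.mem i).phase = .start) ∨
    c.place i = .at u entry ∧
      ((c.mem i).phase = .start ∧ (entry = none → (c.mem i).portEntered = -1) ∨
        (c.mem i).portEntered = entry.elim (-1) (↑) ∧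
          ((c.mem i).phase = .contend ∧ (c.mem i).state = .explore ∧ u ∉ S ∨
            (∃ r ≠ i, c.lock u = some r) ∧
              ((c.mem i).phase = .await true ∧ (c.mem i).state = .explore ∧ u ∉ S ∨
                (c.mem i).phase = .await false)))

/-- The undocked robot `i` carries out a depth-first search and has made `m` moves. -/
inductive Track (L : PortLabeling G) (c : Config V k) (i : Fin k) (m : ℕ) : Prop
  | fresh (u : V) (par : V → ℤ) (hm : m = 0) (hs : (c.mem i).state = .explore)
      (ha : Arriving c i ∅ u none) (hh : Helped c i ∅ par)
  | exploring (D : Trace V) (u : V) (e : ℕ) (hD : IsDfs L m 1 D)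
      (hu : u = nbr L D.top (D.nthPort L D.top (D.off D.top))) (he : (e : ℤ) = portTo L u D.top)
      (hs : (c.mem i).state = .explore) (ha : Arriving c i D.seen u (some e))
      (hh : Helped c i D.seen fun v => portTo L v (D.parent v))
  | backtracking (D : Trace V) (e : ℕ) (hD : IsDfs L m 0 D)
      (he : (e : ℤ) = D.nthPort L D.top (D.off D.top))
      (hs : (c.mem i).state = .backtrack) (ha : Arriving c i D.seen D.top (some e))
      (hh : Helped c i D.seen fun v => portTo L v (D.parent v))
  | returning (D : Trace V) (u : V) (e : ℕ) (hD : IsDfs L m 1 D)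
      (hu : u = nbr L D.top (D.nthPort L D.top (D.off D.top))) (he : (e : ℤ) = portTo L u D.top)
      (hs : (c.mem i).state = .explore) (hseen : (c.mem i).seen = true)
      (hph : (c.mem i).phase = .act false) (hp : c.place i = .at u (some e))
      (hpe : (c.mem i).portEntered = e) (hus : u ∈ D.seen)
      (hh : Helped c i D.seen fun v => portTo L v (D.parent v))
  | leaving (D : Trace V) (lost : Bool) (entry : Option ℕ) (hD : IsDfs L m 0 D)
      (hs : (c.mem i).state ≠ .settled) (hph : (c.mem i).phase = .act lost)
      (hn : ¬((c.mem i).state = .explore ∧ (c.mem i).seen = true ∧ lost = false))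
      (hp : c.place i = .at D.top entry)
      (hpp : (c.mem i).parentPtr = portTo L D.top (D.parent D.top))
      (hpe : ((c.mem i).portEntered + 1) % (G.degree D.top : ℤ) = D.next L)
      (hh : Helped c i D.seen fun v => portTo L v (D.parent v))

variable {L : PortLabeling G} {c c' : Config V k} {i j : Fin k} {u v : V} {m : ℕ}
  {S : Finset V} {par par' : V → ℤ}

/-- An undocked robot has not visited all nodes. -/
theorem Helped.ne_univ (h : Helped c i S par) (hi : (c.mem i).state ≠ .settled)
    (hk : k ≤ Fintype.card V) : S ≠ Finset.univ := by
  rintro rfl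
  choose f hf using fun v => h.docked v (Finset.mem_univ v)
  have hinj : Function.Injective f := by
    intro a b hab
    have ha := (hf a).1
    rw [hab, (hf b).1] at ha
    exact (Option.some.inj ha).symm
  -- Distinct nodes have distinct docked robots, so `k ≤ n` forces every robot to be among them,
  -- robot `i` included.
  have hcard : Fintype.card V = Fintype.card (Fin k) :=
    le_antisymm (Fintype.card_le_of_injective f hinj) (by simpa using hk)
  obtain ⟨v, hv⟩ := ((Fintype.bijective_iff_injective_and_card f).2 ⟨hinj, hcard⟩).2 i
  exact hi (hv ▸ (hf v).2)

/-- If another robot is docked then all degrees are positive. -/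
theorem degree_pos_of_ne (hG : G.Connected) (hk : k ≤ Fintype.card V) (hij : i ≠ j) (v : V) :
    0 < G.degree v := by
  have : Nontrivial V := by
    rw [← Fintype.one_lt_card_iff_nontrivial]
    have := (Fintype.card_fin k) ▸ Fintype.one_lt_card_iff.2 ⟨i, j, hij⟩
    omega
  exact hG.preconnected.degree_pos_of_nontrivial v

theorem Helped.congr (h : Helped c i S par) (hd : ∀ l v, c'.DockedAt l v → c.DockedAt l v)
    (hd' : ∀ l v, c.DockedAt l v → c'.DockedAt l v)
    (hm : ∀ l v, c.DockedAt l v → (c'.mem l).visited i = (c.mem l).visited i ∧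
      (c'.mem l).entryPort i = (c.mem l).entryPort i) : Helped c' i S par where
  docked v hv := (h.docked v hv).imp fun j hj => hd' j v hj
  visited l v hl := (hm l v (hd l v hl)).1.trans (h.visited l v (hd l v hl))
  entryPort l v hl hv := (hm l v (hd l v hl)).2.trans (h.entryPort l v (hd l v hl) hv)

/-- Only helping robot `i` changes the data that the docked robots hold for it. -/
theorem Helped.steps (h : Helped c i S par) (hc : c.Sound) (hst : Steps L j c c')
    (hw : ∀ v, c.DockedAt j v → ¬ c.WaitsAt i v) : Helped c' i S par := by
  have hd' : ∀ l v, c.DockedAt l v → c'.DockedAt l v := fun l v hl => hl.steps hst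
  cases hst with
  | idle => exact h
  | help v e hp hs =>
    refine h.congr (fun l x hl => ?_) hd' fun l x hl => ?_
    · rw [Config.DockedAt, stepHelp_state] at hl
      exact hl
    · have hwi := hw v ⟨by rw [hp]; rfl, hs⟩
      simp only [stepHelp]
      split_ifs with h1
      · subst h1
        simp [hwi]
      all_goals exact ⟨rfl, rfl⟩
  | arrive v p hp =>
    have := hc.transit_start j v p hp
    have := hc.settled_iff j
    refine h.congr (fun l x hl => ?_) hd' fun l x hl => ⟨rfl, rfl⟩
    simp only [Config.DockedAt, Function.update_apply] at *
    grind
  | start v e hp hs hph =>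
    refine h.congr (fun l x hl => ?_) hd' fun l x hl => ?_ <;>
    simp only [stepStart, Config.DockedAt, Function.update_apply] at * <;>
    grind
  | lose v e hp hs hph r hr hl =>
    refine h.congr (fun l x hl => ?_) hd' fun l x hl => ?_ <;>
    simp only [Config.DockedAt, Function.update_apply] at * <;>
    grind
  | act v e lost hp hs hph =>
    refine h.congr (fun l x hl => ?_) hd' fun l x hl => ?_ <;>
    simp only [stepAct, Config.DockedAt, Function.update_apply] at * <;>
    grind
  | dock v e hp hs hph hl =>
    -- A newly docked robot has an empty `visited` array. This is correct because every visited node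
    -- already has a docked robot holding the lock, so docking happens only at a node outside `S`.
    have hvS : v ∉ S := by
      intro hv
      obtain ⟨l, hd⟩ := h.docked v hv
      have h1 := hc.lock_of_docked l v hd
      rcases hl with hl | hl <;> rw [h1] at hl
      · exact absurd hl (by simp)
      · obtain rfl := Option.some.inj hl
        exact hs hd.2
    have key : ∀ l x, Config.DockedAt { c with
        mem := Function.update c.mem j { c.mem j with
          phase := .help
          state := .settled
          visited := fun _ => false
          entryPort := fun _ => -1 }
        lock := Function.update c.lock v (some j) } l x → l = j ∧ x = v ∨ l ≠ j ∧ c.DockedAt l x := by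
      intro l x hd
      by_cases hlj : l = j
      · subst hlj
        have := hd.1
        rw [hp] at this
        exact .inl ⟨rfl, (Option.some.inj this).symm⟩
      · simp only [Config.DockedAt, Function.update_of_ne hlj] at hd
        exact .inr ⟨hlj, hd⟩
    constructor
    · intro x hx
      obtain ⟨l, hl⟩ := h.docked x hx
      exact ⟨l, hd' l x hl⟩
    · intro l x hd
      rcases key l x hd with ⟨rfl, rfl⟩ | ⟨hlj, hd⟩
      · simp [hvS]
      · simpa [hlj] using h.visited l x hd
    · intro l x hd hx
      rcases key l x hd with ⟨rfl, rfl⟩ | ⟨hlj, hd⟩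
      · exact absurd hx hvS
      · simpa [hlj] using h.entryPort l x hd hx

/-- The docked robot at `v` learns that robot `i` has visited `v`. -/
theorem Helped.help (h : Helped c i S par) (hc : c.Sound) (hd : c.DockedAt j v)
    (hw : c.WaitsAt i v) (hpar : ∀ x ∈ S, par' x = par x)
    (hv : v ∉ S → par' v = (c.mem i).portEntered) :
    Helped (stepHelp j v c) i (insert v S) par' := by
  have hdock : ∀ l x, (stepHelp j v c).DockedAt l x ↔ c.DockedAt l x := by
    intro l x
    rw [Config.DockedAt, stepHelp_state]
    rfl
  have hother : ∀ l x, c.DockedAt l x → x ≠ v → (stepHelp j v c).mem l = c.mem l := by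
    intro l x hl hx
    have h1 : l ≠ j := by
      rintro rfl
      have := hl.1
      rw [hd.1] at this
      exact hx (Option.some.inj this).symm
    have h2 : ¬ c.WaitsAt l v := fun hw => hw.2.1 hl.2
    simp only [stepHelp, h1, h2, if_false]
  constructor
  · intro x hx
    rcases Finset.mem_insert.1 hx with rfl | hx
    · exact ⟨j, (hdock _ _).2 hd⟩
    · exact (h.docked x hx).imp fun l hl => (hdock _ _).2 hl
  · intro l x hl
    rw [hdock] at hl
    by_cases hx : x = v
    · subst hx
      obtain rfl := hc.docked_unique hl hd
      have : decide (c.WaitsAt i x) = true := decide_eq_true hw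
      simp only [stepHelp, if_true, this, Bool.or_true]
      simp
    · rw [hother l x hl hx, h.visited l x hl]
      simp [hx]
  · intro l x hl hxS
    rw [hdock] at hl
    by_cases hx : x = v
    · subst hx
      obtain rfl := hc.docked_unique hl hd
      have hvis := h.visited l x hd
      simp only [stepHelp, if_true]
      by_cases hxS : x ∈ S
      · rw [if_neg (by simp [hvis, hxS]), h.entryPort l x hl hxS, hpar x hxS]
      · rw [if_pos ⟨hw, by simp [hvis, hxS]⟩, hv hxS]
    · have hxS := (Finset.mem_insert.1 hxS).resolve_left hx
      rw [hother l x hl hx, h.entryPort l x hl hxS, hpar x hxS]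

theorem Arriving.congr (h : Arriving c i S u entry) (hp : c'.place i = c.place i)
    (hm : c'.mem i = c.mem i) (hl : ∀ r, c.lock u = some r → c'.lock u = some r) :
    Arriving c' i S u entry := by
  unfold Arriving at *
  rw [hp, hm]
  grind

theorem Track.congr (h : Track L c i m) (hp : c'.place i = c.place i) (hm : c'.mem i = c.mem i)
    (hl : ∀ v r, c.lock v = some r → c'.lock v = some r)
    (hh : ∀ S par, Helped c i S par → Helped c' i S par) : Track L c' i m := by
  cases h with
  | fresh u par h0 hs ha h =>
    exact .fresh u par h0 (by rw [hm, hs]) (ha.congr hp hm (hl u)) (hh _ _ h)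
  | exploring D u e hD hu he hs ha h =>
    exact .exploring D u e hD hu he (by rw [hm, hs]) (ha.congr hp hm (hl _)) (hh _ _ h)
  | backtracking D e hD he hs ha h =>
    exact .backtracking D e hD he (by rw [hm, hs]) (ha.congr hp hm (hl _)) (hh _ _ h)
  | returning D u e hD hu he hs hseen hph hp' hpe hus h =>
    rw [← hm] at hs hseen hph hpe
    rw [← hp] at hp'
    exact .returning D u e hD hu he hs hseen hph hp' hpe hus (hh _ _ h)
  | leaving D lost entry hD hs hph hn hp' hpp hpe h =>
    rw [← hm] at hs hn hph hpe hpp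
    rw [← hp] at hp'
    exact .leaving D lost entry hD hs hph hn hp' hpp hpe (hh _ _ h)

end Tracking

/-! ### Preservation of the simulation invariant -/

section TrackSteps

variable {V : Type u} [Fintype V] [DecidableEq V] {G : SimpleGraph V} [DecidableRel G.Adj] {k : ℕ}
variable {L : PortLabeling G} {c c' : Config V k} {i j : Fin k} {u v : V} {m : ℕ}
  {S : Finset V} {par par' : V → ℤ} {entry : Option ℕ}

/-- Robot `i` moves onto an edge. -/
def Moves (c c' : Config V k) (i : Fin k) : Prop :=
  (c.place i).node?.isSome = true ∧ (c'.place i).node? = none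

instance : Decidable (Moves c c' i) := inferInstanceAs (Decidable (_ ∧ _))

theorem Arriving.ne_act (h : Arriving c i S u entry) (lost : Bool) :
    (c.mem i).phase ≠ .act lost := by
  intro hl
  unfold Arriving at h
  rw [hl] at h
  simp at h

/-- Visited nodes carry docked robots, so the robot contends, and hence can lose `MUTEX`, only at a
node outside `S`. A backtracking robot, by `hb`, always finds a docked robot. -/
theorem Arriving.steps (h : Arriving c i S u entry) (hc : c.Sound)
    (hs : (c.mem i).state ≠ .settled) (hS : ∀ x ∈ S, ∃ j, c.DockedAt j x)
    (hb : (c.mem i).state = .backtrack → u ∈ S) (hst : Steps L i c c')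
    (hs' : (c'.mem i).state ≠ .settled) :
    Arriving c' i S u entry ∧ (c'.mem i).state = (c.mem i).state ∧ ¬ Moves c c' i := by
  rcases h with ⟨e, rfl, hp, hph⟩ | ⟨hp, h⟩
  · cases hst with
    | arrive v p hp' =>
      rw [hp] at hp'
      obtain ⟨rfl, rfl⟩ := Place.transit.inj hp'
      refine ⟨.inr ⟨by simp, .inl ⟨hph, by simp⟩⟩, rfl, ?_⟩
      simp [Moves, hp, Place.node?]
    | idle v e' hp' | help v e' hp' | start v e' hp' | dock v e' hp' | lose v e' hp'
    | act v e' lost hp' => rw [hp] at hp'; cases hp'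
  · have hmv : ∀ c' : Config V k, c'.place = c.place → ¬ Moves c c' i := by
      intro c' hc'
      simp [Moves, hc', hp, Place.node?]
    have hnact := Arriving.ne_act (c := c) (.inr ⟨hp, h⟩)
    cases hst with
    | arrive v p hp' => rw [hp] at hp'; cases hp'
    | idle v e' hp' => exact ⟨.inr ⟨hp, h⟩, rfl, hmv _ rfl⟩
    | help v e' hp' hs'' => exact absurd hs'' hs
    | dock => simp at hs'
    | act v e' lost hp' _ hph => exact absurd hph (hnact lost)
    | lose v e' hp' _ hph r hr hl =>
      rw [hp] at hp'
      obtain ⟨rfl, rfl⟩ := Place.at.inj hp'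
      rw [hph] at h
      simp only [reduceCtorEq, false_and, true_and, and_false, or_false, false_or] at h
      refine ⟨.inr ⟨hp, .inr ⟨?_, .inr ⟨⟨r, hr, by simp⟩, .inl ⟨by simp, ?_, h.2.2⟩⟩⟩⟩, ?_,
        hmv _ rfl⟩
      · simpa using h.1
      · simpa using h.2.1
      · simp
    | start v e' hp' _ hph =>
      rw [hp] at hp'
      obtain ⟨rfl, rfl⟩ := Place.at.inj hp'
      rw [hph] at h
      simp only [reduceCtorEq, false_and, true_and, and_false, or_false] at h
      have hpe : ((stepStart i u entry c).mem i).portEntered = entry.elim (-1) (↑) := by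
        cases entry with
        | none => simpa [stepStart] using h
        | some e => simp [stepStart]
      have hstate : ((stepStart i u entry c).mem i).state = (c.mem i).state := by
        cases entry <;> simp [stepStart]
      refine ⟨.inr ⟨hp, .inr ⟨hpe, ?_⟩⟩, hstate, hmv _ rfl⟩
      have hphase : ((stepStart i u entry c).mem i).phase =
          if (c.mem i).state = .backtrack ∨ ∃ j, c.DockedAt j u then .await false
          else .contend := by
        simp [stepStart]
      rw [hphase, hstate]
      split_ifs with hd
      · have hd : ∃ j, c.DockedAt j u := hd.elim (fun h => hS u (hb h)) id
        obtain ⟨r, hr⟩ := hd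
        refine .inr ⟨⟨r, ?_, hc.lock_of_docked r u hr⟩, .inr rfl⟩
        rintro rfl
        exact hs hr.2
      · rw [not_or] at hd
        refine .inl ⟨rfl, ?_, fun hu => hd.2 (hS u hu)⟩
        cases hst : (c.mem i).state <;> simp_all

/-- The end of an iteration in which robot `i` goes back through the port by which it came. -/
theorem stepAct_return {lost : Bool} (h : (c.mem i).state = .explore ∧ (c.mem i).seen = true ∧
    lost = false) : stepAct L i v entry lost c = { c with
      mem := Function.update c.mem i { c.mem i with phase := .start, state := .backtrack }
      place := Function.update c.place i (depart L v entry (c.mem i).portEntered) } := by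
  simp only [stepAct, if_pos h]

/-- The end of an iteration in which robot `i` goes on to the next port. -/
theorem stepAct_next {lost : Bool} (h : ¬((c.mem i).state = .explore ∧ (c.mem i).seen = true ∧
    lost = false)) : stepAct L i v entry lost c = { c with
      mem := Function.update c.mem i { c.mem i with
        phase := .start
        portEntered := ((c.mem i).portEntered + 1) % (G.degree v : ℤ)
        state := if ((c.mem i).portEntered + 1) % (G.degree v : ℤ) = (c.mem i).parentPtr
          then .backtrack else .explore }
      place := Function.update c.place i
        (depart L v entry (((c.mem i).portEntered + 1) % (G.degree v : ℤ))) } := by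
  simp only [stepAct, if_neg h]

/-- Only the step that ends an iteration alters the search: it is `IsDfs.return`, `IsDfs.close` or
`IsDfs.explore`. The robot then does move, because another robot is docked at `D.top`; so there are
two nodes and all degrees are positive. -/
theorem Track.steps_self (h : Track L c i m) (hG : G.Connected) (hk : k ≤ Fintype.card V)
    (hc : c.Sound) (hs : (c.mem i).state ≠ .settled) (hst : Steps L i c c')
    (hs' : (c'.mem i).state ≠ .settled) :
    Track L c' i (m + if Moves c c' i then 1 else 0) ∧
      ((∃ lost, (c.mem i).phase = .act lost) → Moves c c' i) := by
  have hH : ∀ {S par}, Helped c i S par → Helped c' i S par := fun hh =>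
    hh.steps hc hst fun v hv => absurd hv.2 hs
  cases h with
  | fresh u par hm hst' ha hh =>
    obtain ⟨ha', hst'', hmv⟩ := ha.steps hc hs hh.docked (by simp [hst']) hst hs'
    rw [if_neg hmv]
    exact ⟨.fresh u par hm (hst''.trans hst') ha' (hH hh), fun ⟨l, hl⟩ => absurd hl (ha.ne_act l)⟩
  | exploring D u e hD hu he hst' ha hh =>
    obtain ⟨ha', hst'', hmv⟩ := ha.steps hc hs hh.docked (by simp [hst']) hst hs'
    rw [if_neg hmv]
    exact ⟨.exploring D u e hD hu he (hst''.trans hst') ha' (hH hh),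
      fun ⟨l, hl⟩ => absurd hl (ha.ne_act l)⟩
  | backtracking D e hD he hst' ha hh =>
    obtain ⟨ha', hst'', hmv⟩ := ha.steps hc hs hh.docked (fun _ => hD.top_mem) hst hs'
    rw [if_neg hmv]
    exact ⟨.backtracking D e hD he (hst''.trans hst') ha' (hH hh),
      fun ⟨l, hl⟩ => absurd hl (ha.ne_act l)⟩
  | returning D u e hD hu he hst' hseen hph hp hpe hus hh =>
    cases hst with
    | arrive v p hp' => rw [hp] at hp'; cases hp'
    | idle v e' hp' _ hph' => simp [Config.Waits, hph] at hph'
    | help v e' hp' hs'' => exact absurd hs'' hs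
    | dock v e' hp' _ hph' | lose v e' hp' _ hph' | start v e' hp' _ hph' =>
      rw [hph] at hph'; cases hph'
    | act v e' lost hp' _ hph' =>
      rw [hp] at hp'
      obtain ⟨rfl, rfl⟩ := Place.at.inj hp'
      rw [hph] at hph'
      obtain rfl := Phase.act.inj hph'
      obtain ⟨j, hj⟩ := hh.docked _ hD.top_mem
      have hd := degree_pos_of_ne hG hk (i := i) (j := j)
        (by rintro rfl; exact hs hj.2)
      have h0 := Trace.nthPort_nonneg (L := L) (D := D) (hd D.top) (D.off D.top)
      have h1 := Trace.nthPort_lt (L := L) (D := D) (hd D.top) (D.off D.top)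
      have hadj : G.Adj D.top u := hu ▸ adj_nbr h0 h1
      have hport : portTo L D.top u = D.nthPort L D.top (D.off D.top) := by
        rw [hu]; exact portTo_nbr h0 h1
      have hp' : (stepAct L i u (some e) false c).place i = .transit D.top
          (portTo L D.top u).toNat := by
        rw [stepAct_return ⟨hst', hseen, rfl⟩]
        simp only [Function.update_self, hpe, he]
        rw [depart_eq _ (portTo_nonneg hadj.symm) (portTo_lt hadj.symm), nbr_portTo hadj.symm]
      have hmv : Moves c (stepAct L i u (some e) false c) i := by
        simp [Moves, hp, hp', Place.node?]
      rw [if_pos hmv]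
      refine ⟨?_, fun _ => hmv⟩
      have hn0 := portTo_nonneg (L := L) hadj
      refine .backtracking D (portTo L D.top u).toNat (hD.return (hu ▸ hus)) ?_ ?_
        (.inl ⟨_, rfl, hp', ?_⟩) (hH hh)
      · rw [← hport, Int.toNat_of_nonneg hn0]
      · rw [stepAct_return ⟨hst', hseen, rfl⟩]; simp
      · rw [stepAct_return ⟨hst', hseen, rfl⟩]; simp
  | leaving D lost entry hD _ hph hn hp hpp hpe hh =>
    cases hst with
    | arrive v p hp' => rw [hp] at hp'; cases hp'
    | idle v e' hp' _ hph' => simp [Config.Waits, hph] at hph'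
    | help v e' hp' hs'' => exact absurd hs'' hs
    | dock v e' hp' _ hph' | lose v e' hp' _ hph' | start v e' hp' _ hph' =>
      rw [hph] at hph'; cases hph'
    | act v e' lost' hp' _ hph' =>
      rw [hp] at hp'
      obtain ⟨rfl, rfl⟩ := Place.at.inj hp'
      rw [hph] at hph'
      obtain rfl := Phase.act.inj hph'
      obtain ⟨j, hj⟩ := hh.docked _ hD.top_mem
      have hd := degree_pos_of_ne hG hk (i := i) (j := j)
        (by rintro rfl; exact hs hj.2) D.top
      have h0 : 0 ≤ D.next L := Trace.nthPort_nonneg hd _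
      have h1 : D.next L < G.degree D.top := Trace.nthPort_lt hd _
      have hact := stepAct_next (L := L) (v := D.top) (entry := entry) hn
      rw [hpe, hpp, depart_eq _ h0 h1] at hact
      have hp' : (stepAct L i D.top entry lost c).place i = .transit (nbr L D.top (D.next L))
          (portTo L (nbr L D.top (D.next L)) D.top).toNat := by
        rw [hact]; simp
      have hph' : ((stepAct L i D.top entry lost c).mem i).phase = .start := by
        rw [hact]; simp
      have hst' : ((stepAct L i D.top entry lost c).mem i).state =
          if D.next L = portTo L D.top (D.parent D.top) then .backtrack else .explore := by
        rw [hact]; simp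
      have hmv : Moves c (stepAct L i D.top entry lost c) i := by
        simp [Moves, hp, hp', Place.node?]
      rw [if_pos hmv]
      refine ⟨?_, fun _ => hmv⟩
      have hadj := adj_nbr (L := L) h0 h1
      have hn0 := portTo_nonneg (L := L) hadj.symm
      by_cases hnext : D.next L = portTo L D.top (D.parent D.top)
      · rw [if_pos hnext] at hst'
        have hr := hD.top_ne_root hd hnext
        have hpar : nbr L D.top (D.next L) = D.parent D.top := by
          rw [hnext, nbr_portTo (hD.adj_parent _ hD.top_mem hr)]
        rw [hpar] at hp' hn0
        refine .backtracking D.close (portTo L (D.parent D.top) D.top).toNat (hD.close hd hnext)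
          ?_ hst' (.inl ⟨_, rfl, hp', hph'⟩) (hH hh)
        rw [Int.toNat_of_nonneg hn0]
        exact hD.open_port _ hD.top_mem hr hD.top_open
      · rw [if_neg hnext] at hst'
        refine .exploring D.explore (nbr L D.top (D.next L)) _
          (hD.explore hG (hh.ne_univ hs hk) hnext) ?_ (Int.toNat_of_nonneg hn0) hst'
          (.inl ⟨_, rfl, hp', hph'⟩) (hH hh)
        have hoff : D.explore.off D.top = D.off D.top + 1 := Function.update_self ..
        change nbr L D.top (D.nthPort L D.top (D.off D.top + 1)) =
          nbr L D.top (D.nthPort L D.top (D.explore.off D.top))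
        rw [hoff]

/-- The message tells the robot whether the node is new. The first message starts the search, a
later one on exploring extends the path or sends the robot back, and one on backtracking restores
the parent port. -/
theorem Track.steps_help (h : Track L c i m) (hG : G.Connected) (hk : k ≤ Fintype.card V)
    (hc : c.Sound) (hd : c.DockedAt j v) (hw : c.WaitsAt i v) :
    Track L (stepHelp j v c) i m := by
  have hij : i ≠ j := by
    rintro rfl
    exact hw.2.1 hd.2
  have hdeg := degree_pos_of_ne hG hk hij
  have hmem : (stepHelp j v c).mem i = { c.mem i with
      phase := if (c.mem i).phase = .await true then .act true else .act false
      seen := (c.mem j).visited i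
      parentPtr := if (c.mem i).state = .explore ∧ (c.mem j).visited i = false
        then (c.mem i).portEntered else (c.mem j).entryPort i } := by
    simp only [stepHelp, if_neg hij, if_pos hw]
  have hwait : ∀ {S u entry}, Arriving c i S u entry → c.place i = .at u entry ∧ u = v ∧
      (c.mem i).portEntered = entry.elim (-1) (↑) ∧
      ((c.mem i).phase = .await true → u ∉ S) := by
    rintro S u entry (⟨e, rfl, hp, -⟩ | ⟨hp, ha⟩)
    · have := hw.1
      rw [hp] at this
      cases this
    · have hv := hw.1
      rw [hp] at hv
      refine ⟨hp, Option.some.inj hv, ?_⟩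
      rcases hw.2.2 with hph | hph <;> rw [hph] at ha ⊢ <;> simp at ha <;> simp [ha]
  have hphase : ((stepHelp j v c).mem i).phase = .act (decide ((c.mem i).phase = .await true)) := by
    rw [hmem]
    by_cases hl : (c.mem i).phase = .await true <;> simp [hl]
  have hstate := stepHelp_state (c := c) (j := j) (v := v) i
  cases h with
  | fresh u par hm hs ha hh =>
    obtain ⟨hp, rfl, hpe, -⟩ := hwait ha
    have hvis : (c.mem j).visited i = false := by simpa using hh.visited j u hd
    subst hm
    refine .leaving ⟨{u}, ∅, fun _ => u, fun _ => 0, fun _ => 0, u, u⟩ _ none (isDfs_init L u)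
      (by rw [hstate]; exact hw.2.1) hphase ?_ hp ?_ ?_
      (hh.help hc hd hw (by simp) (by simp [hpe, portTo_self]))
    · rw [hmem]; simp [hvis]
    · rw [hmem]; simp [hvis, hs, hpe, portTo_self]
    · rw [hmem]; simp [hpe, Trace.next, Trace.nthPort, portTo_self]
  | exploring D u e hD hu he hs ha hh =>
    obtain ⟨hp, rfl, hpe, hlost⟩ := hwait ha
    have hvis := hh.visited j u hd
    by_cases hus : u ∈ D.seen
    -- At an old node the robot cannot have just lost `MUTEX`, so the test on `lost` does not keep
    -- it from turning back.
    · have hl : (c.mem i).phase ≠ .await true := fun hl => hlost hl hus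
      refine .returning D u e hD hu he (hstate.trans hs) ?_ ?_ hp ?_ hus ?_
      · rw [hmem]; simp [hvis, hus]
      · rw [hphase]; simp [hl]
      · rw [hmem]; simp [hpe]
      · have := hh.help hc hd hw (fun _ _ => rfl) (fun h => absurd hus h)
        rwa [Finset.insert_eq_of_mem hus] at this
    · refine .leaving (D.extend u) _ (some e) (hD.extend (hdeg _) hu hus)
        (by rw [hstate]; exact hw.2.1) hphase ?_ hp ?_ ?_ (hh.help hc hd hw ?_ ?_)
      · rw [hmem]; simp [hvis, hus]
      · rw [hmem]; simp [hvis, hus, hs, hpe, he, Trace.extend]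
      · rw [hmem]; simp [hpe, Trace.next, Trace.nthPort, Trace.extend, hD.off_eq_zero u hus, he]
      · intro x hx
        have : x ≠ u := fun h => hus (h ▸ hx)
        simp [Trace.extend, this]
      · intro _
        simp [hpe, Trace.extend, he]
  | backtracking D e hD he hs ha hh =>
    obtain ⟨hp, rfl, hpe, hlost⟩ := hwait ha
    refine .leaving D _ (some e) hD (by rw [hstate]; exact hw.2.1) hphase ?_ hp ?_ ?_ ?_
    · rw [hstate, hs]; simp
    · rw [hmem]
      simp only [hs, reduceCtorEq, false_and, if_false]
      exact hh.entryPort j _ hd hD.top_mem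
    · rw [hmem]
      -- The robot came back through the port explored last, so its successor modulo the degree is
      -- the next port of the search.
      simp only [hpe, Option.elim, he, Trace.next, Trace.nthPort, Int.emod_add_emod]
      push_cast
      ring_nf
    · have := hh.help hc hd hw (fun _ _ => rfl) (fun h => absurd hD.top_mem h)
      rwa [Finset.insert_eq_of_mem hD.top_mem] at this
  | returning D u e hD hu he hs hseen hph =>
    have := hw.2.2
    simp [Config.Waits, hph] at this
  | leaving D lost entry hD hs hph =>
    have := hw.2.2
    simp [Config.Waits, hph] at this

/-- Another robot affects the place, memory or stored data of `i` only by helping it while it waits.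
-/
theorem Track.steps_of_ne (h : Track L c i m) (hG : G.Connected) (hk : k ≤ Fintype.card V)
    (hc : c.Sound) (hij : i ≠ j) (hst : Steps L j c c') : Track L c' i m := by
  by_cases hw : ∃ v, c.DockedAt j v ∧ c.WaitsAt i v
  · obtain ⟨v, hd, hw⟩ := hw
    obtain ⟨e, hp⟩ := Place.node?_eq_some.1 hd.1
    cases hst with
    | help v' e' hp' =>
      rw [hp] at hp'
      obtain ⟨rfl, rfl⟩ := Place.at.inj hp'
      exact h.steps_help hG hk hc hd hw
    | arrive v' p hp' => rw [hp] at hp'; cases hp'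
    | idle v' e' hp' hs | dock v' e' hp' hs | lose v' e' hp' hs | start v' e' hp' hs
    | act v' e' lost hp' hs => exact absurd hd.2 hs
  · have hw : ∀ v, c.DockedAt j v → ¬ c.WaitsAt i v := fun v hd hwi => hw ⟨v, hd, hwi⟩
    refine h.congr ?_ ?_ (fun v r hl => lock_steps hl hst) fun S par hh => hh.steps hc hst hw
    · cases hst <;> simp [stepHelp, stepStart, stepAct, hij]
    · cases hst with
      | help v e hp hs =>
        have := hw v ⟨by rw [hp]; rfl, hs⟩
        simp only [stepHelp, if_neg hij, if_neg this]
      | _ => simp [stepStart, stepAct, hij]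

end TrackSteps

/-! ### Step bounds and eventual docking -/

section Dispersion

variable {V : Type u} [Fintype V] [DecidableEq V] {G : SimpleGraph V} [DecidableRel G.Adj] {k : ℕ}
variable {L : PortLabeling G} {c c' : Config V k} {i j : Fin k} {v : V} {m : ℕ}

theorem track_init (L : PortLabeling G) (s : Fin k → V) (i : Fin k) :
    Track L (Config.init s) i 0 := by
  refine .fresh (s i) (fun _ => 0) rfl rfl (.inr ⟨rfl, .inl ⟨rfl, fun _ => rfl⟩⟩) ⟨?_, ?_, ?_⟩
  · simp
  · exact fun j v hd => absurd hd.2 (by simp [Config.init, Memory.init])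
  · simp

theorem Track.moves_le (h : Track L c i m) (hG : G.Connected) :
    m + 2 * (Fintype.card V - 1) ≤ 4 * G.edgeFinset.card := by
  cases h with
  | fresh u par hm => exact hm ▸ (isDfs_init L u).moves_le hG
  | exploring D u e hD | backtracking D e hD | returning D u e hD | leaving D lost entry hD =>
    exact hD.moves_le hG

/-- This excludes deadlock: nobody waits at a node without a designated helper other than itself. -/
theorem Track.waits (h : Track L c i m) (hw : c.Waits i) :
    ∃ u, c.WaitsAt i u ∧ ∃ r ≠ i, c.lock u = some r := by
  have key : ∀ {S u entry}, (c.mem i).state ≠ .settled → Arriving c i S u entry →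
      ∃ u, c.WaitsAt i u ∧ ∃ r ≠ i, c.lock u = some r := by
    rintro S u entry hs (⟨e, -, hp, hph⟩ | ⟨hp, ha⟩)
    · simp [Config.Waits, hph] at hw
    · refine ⟨u, ⟨by rw [hp]; rfl, hs, hw⟩, ?_⟩
      rcases hw with hw | hw <;> rw [hw] at ha <;> simp at ha
      · exact ha.2
      · exact ha.2.1
  cases h with
  | fresh u par hm hs ha => exact key (by simp [hs]) ha
  | exploring D u e hD hu he hs ha => exact key (by simp [hs]) ha
  | backtracking D e hD he hs ha => exact key (by simp [hs]) ha
  | returning D u e hD hu he hs hseen hph => simp [Config.Waits, hph] at hw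
  | leaving D lost entry hD hs hph => simp [Config.Waits, hph] at hw

theorem Steps.place_of_ne (hst : Steps L j c c') (hij : i ≠ j) : c'.place i = c.place i := by
  cases hst <;> simp [stepHelp, stepStart, stepAct, hij]

theorem Steps.mem_of_ne (hst : Steps L j c c') (hij : i ≠ j) (hw : ¬ c.Waits i) :
    c'.mem i = c.mem i := by
  cases hst with
  | help v e hp hs =>
    have : ¬ c.WaitsAt i v := fun h => hw h.2.2
    simp only [stepHelp, if_neg hij, if_neg this]
  | _ => simp [stepStart, stepAct, hij]

theorem Config.Sound.exists_dockedAt (hc : c.Sound) (hs : (c.mem i).state = .settled) :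
    ∃ v, c.DockedAt i v := by
  rcases hp : c.place i with ⟨v, e⟩ | ⟨v, e⟩
  · exact ⟨v, by rw [hp]; rfl, hs⟩
  · have := hc.transit_start i v e hp
    rw [(hc.settled_iff i).1 hs] at this
    cases this

theorem Config.Sound.settled_steps (hc : c.Sound) (hs : (c.mem i).state = .settled)
    (hst : Steps L j c c') : (c'.mem i).state = .settled :=
  have ⟨_, hd⟩ := hc.exists_dockedAt hs
  (hd.steps hst).2

/-- The number of active steps, at most, of robot `i` since its last move. -/
def stage (c : Config V k) (i : Fin k) : ℕ :=
  if (c.place i).node? = none then 0 else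
  if (c.mem i).phase = .start then 1 else
  if (c.mem i).phase = .contend then 2 else 3

theorem stage_le : stage c i ≤ 3 := by
  unfold stage
  split_ifs <;> omega

theorem Steps.stage_of_ne (hst : Steps L j c c') (hij : i ≠ j) : stage c i ≤ stage c' i := by
  unfold stage
  rw [hst.place_of_ne hij]
  by_cases hw : c.Waits i
  · have h1 : (c'.mem i).phase ≠ .start ∧ (c'.mem i).phase ≠ .contend := by
      cases hst with
      | help v e hp hs =>
        rw [stepHelp_phase hs]
        rcases hw with hw | hw <;> split_ifs <;> simp [hw]
      | _ => rcases hw with hw | hw <;> simp [stepStart, stepAct, hij, hw]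
    simp only [h1, if_false]
    split_ifs <;> omega
  · rw [hst.mem_of_ne hij hw]

/-- `stage` is a potential: an active step raises it, except a move, which releases at most three
units. Arriving, starting, contending and acting make four active steps per move. -/
theorem Steps.stage_self (hst : Steps L i c c') (hs : (c.mem i).state ≠ .settled)
    (hc : c.Sound) (hact : (∃ lost, (c.mem i).phase = .act lost) → Moves c c' i) :
    stage c i + (if c.Waits i then 0 else 1) ≤ 4 * (if Moves c c' i then 1 else 0) + stage c' i := by
  cases hst with
  | arrive v p hp =>
    have hph := hc.transit_start i v p hp
    simp [stage, hp, hph, Place.node?]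
    split_ifs <;> omega
  | help v e hp hs' => exact absurd hs' hs
  | start v e hp _ hph =>
    simp [stage, stepStart, hp, hph, Place.node?]
    split_ifs <;> simp_all
  | dock v e hp _ hph hl =>
    simp [stage, hp, hph, Place.node?]
    split_ifs <;> omega
  | lose v e hp _ hph r hr hl =>
    simp [stage, hp, hph, Place.node?]
    split_ifs <;> omega
  | act v e lost hp _ hph =>
    have := stage_le (c := c) (i := i)
    rw [if_pos (hact ⟨lost, hph⟩)]
    split_ifs <;> omega
  | idle v e hp _ hph =>
    have hne : (c.mem i).phase ≠ .help := fun h => hs ((hc.settled_iff i).2 h)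
    rw [if_pos (hph.resolve_right hne)]
    omega

variable {s : Fin k → V} {sched choice : ℕ → Fin k}

theorem moves_succ (i : Fin k) (t : ℕ) : moves L s sched choice i (t + 1) =
    moves L s sched choice i t + if sched t = i ∧ Moves (run L s sched choice t)
      (run L s sched choice (t + 1)) i then 1 else 0 := by
  unfold moves
  rw [Finset.range_add_one, Finset.filter_insert]
  change Finset.card (if sched t = i ∧ Moves _ _ i then _ else _) = _
  split_ifs with h
  · rw [Finset.card_insert_of_notMem (by simp)]
  · rfl

theorem activeSteps_succ (i : Fin k) (t : ℕ) : activeSteps L s sched choice i (t + 1) =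
    activeSteps L s sched choice i t +
      if sched t = i ∧ ((run L s sched choice t).mem i).state ≠ .settled ∧
        ¬ (run L s sched choice t).Waits i then 1 else 0 := by
  unfold activeSteps
  rw [Finset.range_add_one, Finset.filter_insert]
  split_ifs with h
  · rw [Finset.card_insert_of_notMem (by simp)]
  · rfl

theorem track_run (hG : G.Connected) (hk : k ≤ Fintype.card V) (i : Fin k) (t : ℕ)
    (hs : ((run L s sched choice t).mem i).state ≠ .settled) :
    Track L (run L s sched choice t) i (moves L s sched choice i t) := by
  induction t with
  | zero => exact track_init L s i
  | succ t ih =>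
    have hst := steps_run (L := L) (s := s) (sched := sched) (choice := choice) t
    have hc := sound_run (L := L) (s := s) (sched := sched) (choice := choice) t
    have hs' : ((run L s sched choice t).mem i).state ≠ .settled :=
      fun h => hs (hc.settled_steps h hst)
    rw [moves_succ]
    by_cases hi : sched t = i
    · simp only [hi, true_and]
      rw [hi] at hst
      exact ((ih hs').steps_self hG hk hc hs' hst hs).1
    · simp only [hi, false_and, if_false]
      exact (ih hs').steps_of_ne hG hk hc (Ne.symm hi) hst

theorem moves_le (hG : G.Connected) (hk : k ≤ Fintype.card V) (i : Fin k) (t : ℕ) :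
    moves L s sched choice i t + 2 * (Fintype.card V - 1) ≤ 4 * G.edgeFinset.card := by
  induction t with
  | zero => exact (track_init L s i).moves_le hG
  | succ t ih =>
    by_cases hs : ((run L s sched choice (t + 1)).mem i).state = .settled
    · obtain ⟨v, hd⟩ := (sound_run (t + 1)).exists_dockedAt hs
      have : ¬ Moves (run L s sched choice t) (run L s sched choice (t + 1)) i := by
        intro hm
        have := hm.2
        rw [hd.1] at this
        cases this
      rw [moves_succ]
      simpa [this] using ih
    · exact (track_run hG hk i (t + 1) hs).moves_le hG

theorem Steps.state_of_act (hst : Steps L i c c') (h : ∃ lost, (c.mem i).phase = .act lost)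
    (hs : (c.mem i).state ≠ .settled) : (c'.mem i).state ≠ .settled := by
  obtain ⟨l, hl⟩ := h
  cases hst with
  | act v e lost hp _ hph =>
    simp only [stepAct, Function.update_self]
    split_ifs <;> simp
  | arrive => exact hs
  | idle => exact hs
  | help v e hp hs' => exact absurd hs' hs
  | start v e hp _ hph | dock v e hp _ hph | lose v e hp _ hph => rw [hl] at hph; cases hph

theorem activeSteps_le (hG : G.Connected) (hk : k ≤ Fintype.card V) (i : Fin k) (t : ℕ) :
    activeSteps L s sched choice i t ≤
      4 * moves L s sched choice i t + stage (run L s sched choice t) i := by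
  induction t with
  | zero => simp [activeSteps]
  | succ t ih =>
    have hst := steps_run (L := L) (s := s) (sched := sched) (choice := choice) t
    have hc := sound_run (L := L) (s := s) (sched := sched) (choice := choice) t
    rw [moves_succ, activeSteps_succ]
    by_cases hs : ((run L s sched choice t).mem i).state = .settled
    · have hs' := hc.settled_steps hs hst
      have hc' := hc.steps hst
      obtain ⟨v, hd⟩ := hc'.exists_dockedAt hs'
      have h1 := (hc'.settled_iff i).1 hs'
      -- After docking the potential stays at its maximum, so the bound persists.
      have h2 : stage (run L s sched choice (t + 1)) i = 3 := by simp [stage, hd.1, h1]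
      have h3 := stage_le (c := run L s sched choice t) (i := i)
      simp only [hs, ne_eq, not_true_eq_false, false_and, and_false, if_false]
      omega
    · by_cases hi : sched t = i
      · rw [hi] at hst
        have := hst.stage_self hs hc fun hl => ((track_run hG hk i t hs).steps_self hG hk hc hs hst
          (hst.state_of_act hl hs)).2 hl
        simp only [hi, hs, ne_eq, not_false_eq_true, true_and]
        split_ifs at this ⊢ <;> simp_all <;> omega
      · have := hst.stage_of_ne (Ne.symm hi)
        simp only [hi, false_and, if_false]
        omega

theorem activeSteps_le_edges (hG : G.Connected) (hk : k ≤ Fintype.card V) (i : Fin k) (t : ℕ) :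
    activeSteps L s sched choice i t ≤ 19 * max 1 G.edgeFinset.card := by
  have h1 := activeSteps_le (L := L) (s := s) (sched := sched) (choice := choice) hG hk i t
  have h2 := moves_le (L := L) (s := s) (sched := sched) (choice := choice) hG hk i t
  have h3 := stage_le (c := run L s sched choice t) (i := i)
  -- With at most `4m` moves, active steps number at most `4 * 4m + 3`, whence the constant 19.
  omega

/-- A robot that never docks waits for ever from some time on. -/
theorem exists_waits (hG : G.Connected) (hk : k ≤ Fintype.card V) {i : Fin k}
    (hact : ActiveForever sched i)
    (hs : ∀ t, ((run L s sched choice t).mem i).state ≠ .settled) :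
    ∃ T, ∀ t ≥ T, (run L s sched choice t).Waits i := by
  -- At this time the bounded monotone count of active steps has reached its maximum; any later step
  -- of the robot is mere waiting.
  let T := Function.argmin
    fun t => 19 * max 1 G.edgeFinset.card - activeSteps L s sched choice i t
  have hT : ∀ t ≥ T, activeSteps L s sched choice i t ≤ activeSteps L s sched choice i T := by
    intro t _
    have h1 := Function.argmin_le
      (fun t => 19 * max 1 G.edgeFinset.card - activeSteps L s sched choice i t) t
    have h2 := activeSteps_le_edges (L := L) (s := s) (sched := sched) (choice := choice) hG hk i t
    have h3 := activeSteps_le_edges (L := L) (s := s) (sched := sched) (choice := choice) hG hk i T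
    change 19 * max 1 G.edgeFinset.card - activeSteps L s sched choice i T ≤
      19 * max 1 G.edgeFinset.card - activeSteps L s sched choice i t at h1
    omega
  have hmono : ∀ t ≥ T, activeSteps L s sched choice i T ≤ activeSteps L s sched choice i t := by
    intro t ht
    exact Finset.card_le_card (Finset.filter_subset_filter _ (Finset.range_mono ht))
  have hstep : ∀ t ≥ T, sched t = i → (run L s sched choice t).Waits i := by
    intro t ht hi
    by_contra hw
    have h1 := hT (t + 1) (by omega)
    have h2 := hmono t ht
    rw [activeSteps_succ, if_pos ⟨hi, hs t, hw⟩] at h1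
    omega
  refine ⟨T, fun t ht => ?_⟩
  by_contra hw
  -- Other robots do not change the memory of a robot that is not waiting, so it would still not be
  -- waiting at its own next step.
  have hnever : ∀ t' ≥ t, ¬ (run L s sched choice t').Waits i := by
    intro t' ht'
    induction t', ht' using Nat.le_induction with
    | base => exact hw
    | succ t' ht' ih =>
      have hi : i ≠ sched t' := fun hi => ih (hstep t' (ht.trans ht') hi.symm)
      have h1 := (steps_run (L := L) (s := s) (sched := sched) (choice := choice) t').mem_of_ne hi ih
      rwa [Config.Waits, h1]
  obtain ⟨t', ht', hi⟩ := hact t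
  exact hnever t' ht' (hstep t' (ht.trans ht') hi)

theorem exists_settled (hG : G.Connected) (hk : k ≤ Fintype.card V)
    (hact : ∀ i, ActiveForever sched i) (i : Fin k) :
    ∃ t, ((run L s sched choice t).mem i).state = .settled := by
  by_contra! hs
  obtain ⟨T, hT⟩ := exists_waits (L := L) (s := s) (choice := choice) hG hk (hact i) hs
  obtain ⟨u, hu, r, hr, hl⟩ := (track_run hG hk i T (hs T)).waits (hT T le_rfl)
  have hplace : ∀ t ≥ T, (run L s sched choice t).WaitsAt i u := by
    intro t ht
    induction t, ht using Nat.le_induction with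
    | base => exact hu
    | succ t ht ih =>
      refine ⟨?_, hs _, hT _ (by omega)⟩
      have hst := steps_run (L := L) (s := s) (sched := sched) (choice := choice) t
      by_cases hi : sched t = i
      · rw [hi] at hst
        have hph := hT t ht
        generalize run L s sched choice (t + 1) = c' at hst ⊢
        cases hst with
        | idle => exact ih.1
        | arrive v p hp =>
          have h1 := ih.1
          rw [hp] at h1
          cases h1
        | help v e hp hs' => exact absurd hs' (hs t)
        | start v e hp _ hph' | dock v e hp _ hph' | lose v e hp _ hph'
        | act v e lost hp _ hph' => simp [Config.Waits, hph'] at hph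
      · rw [hst.place_of_ne (Ne.symm hi)]
        exact ih.1
  -- One step of the winner `r` makes sure that it is docked; a second one answers robot `i`, which
  -- then stops waiting.
  obtain ⟨t₁, ht₁, hi₁⟩ := hact r T
  have hd : (run L s sched choice (t₁ + 1)).DockedAt r u := by
    have hst := steps_run (L := L) (s := s) (sched := sched) (choice := choice) t₁
    have hc := sound_run (L := L) (s := s) (sched := sched) (choice := choice) t₁
    have hl₁ := lock_run ht₁ hl
    obtain ⟨hp, hph⟩ := hc.lock_spec r u hl₁
    by_cases hrs : ((run L s sched choice t₁).mem r).state = .settled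
    · exact Config.DockedAt.steps ⟨hp, hrs⟩ hst
    · have hph := hph.resolve_left fun h => hrs ((hc.settled_iff r).2 h)
      rw [hi₁] at hst
      obtain ⟨e, he⟩ := Place.node?_eq_some.1 hp
      generalize run L s sched choice (t₁ + 1) = c' at hst ⊢
      cases hst with
      | dock v e' hp' => exact ⟨hp, by simp⟩
      | lose v e' hp' _ _ r' hr' hl' =>
        rw [he] at hp'
        obtain ⟨rfl, rfl⟩ := Place.at.inj hp'
        rw [hl₁] at hl'
        rcases hl' with hl' | hl'
        · exact absurd (Option.some.inj hl').symm hr'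
        · exact absurd hl'.1 (by simp)
      | arrive v p hp' => rw [he] at hp'; cases hp'
      | help v e hp hs' => exact absurd hs' hrs
      | idle v e hp _ hph' => simp [Config.Waits, hph] at hph'
      | start v e hp _ hph' | act v e lost hp _ hph' => rw [hph] at hph'; cases hph'
  obtain ⟨t₂, ht₂, hi₂⟩ := hact r (t₁ + 1)
  have hd₂ := docked_run ht₂ hd
  have hw := hplace t₂ (by omega)
  have hst := steps_run (L := L) (s := s) (sched := sched) (choice := choice) t₂
  rw [hi₂] at hst
  have hw' := hT (t₂ + 1) (by omega)
  obtain ⟨e, he⟩ := Place.node?_eq_some.1 hd₂.1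
  generalize run L s sched choice (t₂ + 1) = c' at hst hw'
  cases hst with
  | help v e' hp' hs' =>
    rw [he] at hp'
    obtain ⟨rfl, rfl⟩ := Place.at.inj hp'
    rw [Config.Waits, stepHelp_phase hs', if_pos hw] at hw'
    split_ifs at hw' <;> simp at hw'
  | arrive v p hp' => rw [he] at hp'; cases hp'
  | idle v e hp hs' | start v e hp hs' | dock v e hp hs' | lose v e hp hs'
  | act v e lost hp hs' => exact hs' hd₂.2

theorem dispersion (hG : G.Connected) (hk : k ≤ Fintype.card V)
    (hact : ∀ i, ActiveForever sched i) :
    ∃ f : Fin k → V, Function.Injective f ∧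
      ∃ T : ℕ, ∀ t ≥ T, ∀ i, (run L s sched choice t).DockedAt i (f i) := by
  choose τ hτ using exists_settled (L := L) (s := s) (choice := choice) hG hk hact
  choose f hf using fun i => (sound_run (τ i)).exists_dockedAt (hτ i)
  have hT : ∀ t ≥ Finset.univ.sup τ, ∀ i, (run L s sched choice t).DockedAt i (f i) :=
    fun t ht i => docked_run ((Finset.le_sup (Finset.mem_univ i)).trans ht) (hf i)
  refine ⟨f, fun i j hij => ?_, _, hT⟩
  have hi := hT _ le_rfl i
  rw [hij] at hi
  exact (sound_run _).docked_unique hi (hT _ le_rfl j)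

end Dispersion

/-! ### Memory size -/

section MemorySize

variable {V : Type u} [Fintype V] [DecidableEq V] {G : SimpleGraph V} [DecidableRel G.Adj]
variable {k Δ : ℕ} {L : PortLabeling G} {c c' : Config V k} {i j : Fin k}

/-- All ports in a memory are less than `Δ`. -/
structure Memory.Bounded (Δ : ℕ) (m : Memory k) : Prop where
  portEntered : -1 ≤ m.portEntered ∧ m.portEntered < Δ
  parentPtr : -1 ≤ m.parentPtr ∧ m.parentPtr < Δ
  entryPort : ∀ x, -1 ≤ m.entryPort x ∧ m.entryPort x < Δ

/-- The port through which a robot has entered, or is going to enter, its node. -/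
def Place.entry {V : Type u} : Place V → Option ℕ
  | .at _ e => e
  | .transit _ e => some e

theorem entry_depart {v : V} {entry : Option ℕ} {p : ℤ} {e : ℕ}
    (h : (depart L v entry p).entry = some e) : entry = some e ∨ ∃ u, e < G.degree u := by
  rcases hq : depart L v entry p with ⟨u, e'⟩ | ⟨u, e'⟩
  · rw [hq] at h
    unfold depart at hq
    split_ifs at hq
    obtain ⟨rfl, rfl⟩ := Place.at.inj hq
    exact .inl h
  · rw [hq] at h
    obtain rfl := Option.some.inj h
    exact .inr ⟨u, depart_of_lt entry hq⟩

/-- All ports in a configuration are less than `Δ`. -/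
structure Config.Bounded (Δ : ℕ) (c : Config V k) : Prop where
  mem : ∀ i, (c.mem i).Bounded Δ
  entry : ∀ i e, (c.place i).entry = some e → e < Δ
  -- A message comes from another robot, so a robot about to move lives in a graph with positive
  -- degrees. Without this, reduction modulo degree zero would not bound the selected port.
  act : ∀ i lost, (c.mem i).phase = .act lost → ∃ j, i ≠ j

theorem bounded_init (s : Fin k → V) : (Config.init s).Bounded Δ := by
  constructor
  · exact fun i => ⟨by simp [Config.init, Memory.init]; omega,
      by simp [Config.init, Memory.init]; omega, by simp [Config.init, Memory.init]; omega⟩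
  · simp [Config.init, Place.entry]
  · simp [Config.init, Memory.init]

theorem Config.Bounded.steps (h : c.Bounded Δ) (hG : G.Connected) (hk : k ≤ Fintype.card V)
    (hΔ : G.maxDegree ≤ Δ) (hst : Steps L j c c') : c'.Bounded Δ := by
  have hmem : ∀ (f : Memory k) (c' : Config V k), c'.mem = Function.update c.mem j f →
      f.Bounded Δ → ∀ i, (c'.mem i).Bounded Δ := by
    intro f c' hc' hf i
    rw [hc']
    by_cases hi : i = j
    · subst hi
      simpa using hf
    · simpa [hi] using h.mem i
  have hactp : ∀ (f : Memory k) (c' : Config V k), c'.mem = Function.update c.mem j f →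
      (∀ lost, f.phase ≠ .act lost) → ∀ i lost, (c'.mem i).phase = .act lost → ∃ j, i ≠ j := by
    intro f c' hc' hf i lost
    rw [hc']
    by_cases hi : i = j
    · subst hi
      simpa using fun h => absurd h (hf lost)
    · simpa [hi] using h.act i lost
  have hj := h.mem j
  cases hst with
  | idle => exact h
  | arrive v p hp =>
    refine ⟨h.mem, fun i e he => ?_, h.act⟩
    by_cases hi : i = j
    · subst hi
      refine h.entry i e ?_
      rw [hp]
      simpa [Place.entry] using he
    · exact h.entry i e (by simpa [hi] using he)
  | help v e hp hs =>
    refine ⟨fun i => ?_, h.entry, fun i lost hph => ?_⟩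
    · have hi := h.mem i
      simp only [stepHelp]
      split_ifs with h1
      · refine ⟨hj.portEntered, hj.parentPtr, fun x => ?_⟩
        dsimp only
        split_ifs
        · exact (h.mem x).portEntered
        · exact hj.entryPort x
      all_goals first
        | exact hi
        | exact ⟨hi.portEntered, hi.portEntered, hi.entryPort⟩
        | exact ⟨hi.portEntered, hj.entryPort i, hi.entryPort⟩
    · by_cases hi : i = j
      · subst hi
        rw [stepHelp_phase hs, if_neg (fun hw => hw.2.1 hs)] at hph
        exact h.act i lost hph
      · exact ⟨j, hi⟩
  | start v e hp hs hph =>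
    refine ⟨hmem _ _ rfl ?_, h.entry, hactp _ _ rfl ?_⟩
    · cases e with
      | none => exact ⟨hj.portEntered, hj.parentPtr, hj.entryPort⟩
      | some p =>
        have := h.entry j p (by rw [hp]; rfl)
        exact ⟨by dsimp only; omega, by dsimp only; omega, hj.entryPort⟩
    · intro lost
      dsimp only
      split_ifs <;> simp
  | dock v e hp hs hph hl =>
    refine ⟨hmem _ _ rfl ⟨hj.portEntered, hj.parentPtr, ?_⟩, h.entry, hactp _ _ rfl (by simp)⟩
    intro x
    dsimp only
    omega
  | lose v e hp hs hph r hr hl =>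
    exact ⟨hmem _ _ rfl ⟨hj.portEntered, hj.parentPtr, hj.entryPort⟩, h.entry,
      hactp _ _ rfl (by simp)⟩
  | act v e lost hp hs hph =>
    obtain ⟨l, hl⟩ := h.act j lost hph
    have hd := degree_pos_of_ne hG hk hl v
    have hdΔ := (G.degree_le_maxDegree v).trans hΔ
    refine ⟨hmem _ _ rfl ?_, fun i e' he => ?_, hactp _ _ rfl ?_⟩
    · split_ifs
      · exact ⟨hj.portEntered, hj.parentPtr, hj.entryPort⟩
      all_goals
        refine ⟨?_, hj.parentPtr, hj.entryPort⟩
        dsimp only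
        have h1 := Int.emod_nonneg ((c.mem j).portEntered + 1) (b := G.degree v) (by omega)
        have h2 := Int.emod_lt_of_pos ((c.mem j).portEntered + 1) (b := G.degree v) (by omega)
        omega
    · by_cases hi : i = j
      · subst hi
        simp only [stepAct, Function.update_self] at he
        rcases entry_depart he with he | ⟨u, hu⟩
        · exact h.entry i e' (by rw [hp]; exact he)
        · exact hu.trans_le ((G.degree_le_maxDegree u).trans hΔ)
      · exact h.entry i e' (by simpa [stepAct, hi] using he)
    · intro lost
      split_ifs <;> simp

theorem bounded_run {s : Fin k → V} {sched choice : ℕ → Fin k} (hG : G.Connected)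
    (hk : k ≤ Fintype.card V) (hΔ : G.maxDegree ≤ Δ) (t : ℕ) :
    (run L s sched choice t).Bounded Δ := by
  induction t with
  | zero => exact bounded_init s
  | succ t ih => exact ih.steps hG hk hΔ (steps_run t)

/-- The labels and memories of the robots, for ports less than `Δ`, as a finite type. -/
abbrev Code (k Δ : ℕ) : Type :=
  Fin k × Fin 7 × Fin 3 × Bool × Fin (Δ + 1) × Fin (Δ + 1) × (Fin k → Bool) ×
    (Fin k → Fin (Δ + 1))

/-- The label and memory that belong to a code. -/
def Code.decode (x : Code k Δ) : Fin k × Memory k :=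
  (x.1, {
    phase := ![.start, .contend, .await false, .await true, .act false, .act true, .help] x.2.1
    state := ![.explore, .backtrack, .settled] x.2.2.1
    seen := x.2.2.2.1
    portEntered := (x.2.2.2.2.1 : ℕ) - 1
    parentPtr := (x.2.2.2.2.2.1 : ℕ) - 1
    visited := x.2.2.2.2.2.2.1
    entryPort := fun y => (x.2.2.2.2.2.2.2 y : ℕ) - 1 })

theorem exists_code (i : Fin k) {m : Memory k} (hm : m.Bounded Δ) :
    ∃ x : Code k Δ, x.decode = (i, m) := by
  have hp : ∀ p : ℤ, -1 ≤ p ∧ p < Δ → ∃ x : Fin (Δ + 1), ((x : ℕ) : ℤ) - 1 = p := fun p hp =>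
    ⟨⟨(p + 1).toNat, by omega⟩, by dsimp only; omega⟩
  obtain ⟨phase, state, portEntered, parentPtr, seen, visited, entryPort⟩ := m
  obtain ⟨h1, h2, h3⟩ := hm
  obtain ⟨a, ha⟩ := hp _ h1
  obtain ⟨b, hb⟩ := hp _ h2
  choose f hf using fun x => hp _ (h3 x)
  have hphase : ∃ x, ![Phase.start, .contend, .await false, .await true, .act false, .act true,
      .help] x = phase := by
    rcases phase with _ | _ | l | l | _
    · exact ⟨0, rfl⟩
    · exact ⟨1, rfl⟩
    · cases l
      · exact ⟨2, rfl⟩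
      · exact ⟨3, rfl⟩
    · cases l
      · exact ⟨4, rfl⟩
      · exact ⟨5, rfl⟩
    · exact ⟨6, rfl⟩
  have hstate : ∃ x, ![RobotState.explore, .backtrack, .settled] x = state := by
    cases state
    · exact ⟨0, rfl⟩
    · exact ⟨1, rfl⟩
    · exact ⟨2, rfl⟩
  obtain ⟨x, hx⟩ := hphase
  obtain ⟨y, hy⟩ := hstate
  refine ⟨(i, x, y, seen, a, b, visited, f), ?_⟩
  simp only [Code.decode, hx, hy]
  simp only at ha hb hf
  simp only [ha, hb, hf]

theorem card_code_le (k Δ : ℕ) :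
    Fintype.card (Code k Δ) ≤ 2 ^ (2 * k + 6 + (k + 2) * (Nat.log 2 Δ + 1)) := by
  have hk : k ≤ 2 ^ k := Nat.lt_two_pow_self.le
  have hΔ : Δ + 1 ≤ 2 ^ (Nat.log 2 Δ + 1) := Nat.lt_pow_succ_log_self (by norm_num) Δ
  have hcard : Fintype.card (Code k Δ) = k * (42 * (2 ^ k * (Δ + 1) ^ (k + 2))) := by
    simp only [Fintype.card_prod, Fintype.card_fin, Fintype.card_bool, Fintype.card_fun]
    ring
  rw [hcard]
  -- Here 42 counts phases, states and `seen` together and is at most `2 ^ 6`; there are `k + 2`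
  -- stored ports, each with `Δ + 1` values.
  calc k * (42 * (2 ^ k * (Δ + 1) ^ (k + 2)))
      ≤ 2 ^ k * (2 ^ 6 * (2 ^ k * (2 ^ (Nat.log 2 Δ + 1)) ^ (k + 2))) := by
        gcongr
        norm_num
    _ = 2 ^ (2 * k + 6 + (k + 2) * (Nat.log 2 Δ + 1)) := by
        rw [← pow_mul]
        ring

theorem bits_le (hk : 1 ≤ k) : ((2 * k + 6 + (k + 2) * (Nat.log 2 Δ + 1) : ℕ) : ℝ) ≤
    (14 : ℕ) * (k * max 1 (Real.logb 2 Δ)) := by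
  have h1 : (Nat.log 2 Δ : ℝ) ≤ Real.logb 2 Δ := by
    exact_mod_cast Real.natLog_le_logb Δ 2
  have h2 : (1 : ℝ) ≤ max 1 (Real.logb 2 Δ) := le_max_left _ _
  have h3 : Real.logb 2 Δ ≤ max 1 (Real.logb 2 Δ) := le_max_right _ _
  have h4 : (1 : ℝ) ≤ k := by exact_mod_cast hk
  push_cast
  generalize max 1 (Real.logb 2 Δ) = x at *
  -- Together with `2 * k + 6 ≤ 8 * k`, this gives the constant 14 = 8 + 6.
  have h5 : ((k : ℝ) + 2) * (Nat.log 2 Δ + 1) ≤ (3 * k) * (2 * x) := by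
    gcongr <;> linarith
  nlinarith

theorem exists_decode (k Δ : ℕ) (hk : 1 ≤ k) :
    ∃ (B : ℕ) (decode : (Fin B → Bool) → Fin k × Memory k),
      (B : ℝ) ≤ (14 : ℕ) * (k * max 1 (Real.logb 2 Δ)) ∧
      ∀ (i : Fin k) (m : Memory k), m.Bounded Δ → ∃ bits, decode bits = (i, m) := by
  have : Nonempty (Code k Δ) := ⟨(⟨0, hk⟩, 0, 0, false, 0, 0, fun _ => false, 0)⟩
  obtain ⟨f⟩ := Function.Embedding.nonempty_of_card_le (α := Code k Δ)
    (β := Fin (2 * k + 6 + (k + 2) * (Nat.log 2 Δ + 1)) → Bool)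
    (by simpa only [Fintype.card_fun, Fintype.card_bool, Fintype.card_fin] using card_code_le k Δ)
  refine ⟨_, fun b => (Function.invFun f b).decode, bits_le hk, fun i m hm => ?_⟩
  obtain ⟨x, hx⟩ := exists_code i hm
  exact ⟨f x, by dsimp only; rw [Function.leftInverse_invFun f.injective x, hx]⟩

end MemorySize

/-! ### A docked robot that stops helping -/

section Stopping

/-- The labelling of the ports by an arbitrary numbering of the neighbours. -/
noncomputable def someLabeling {V : Type u} [Fintype V] [DecidableEq V] (G : SimpleGraph V)
    [DecidableRel G.Adj] : PortLabeling G where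
  port v := Fintype.equivFinOfCardEq (G.card_neighborSet_eq_degree v)

/-- Robot `0` is docked at node `0`, and robot `1` is at the same node, with memory `m`. -/
def dockedPair (m : Memory 2) : Config (Fin 2) 2 where
  place _ := .at 0 none
  mem := ![{ Memory.init 2 with phase := .help, state := .settled }, m]
  lock := Function.update (fun _ => none) 0 (some 0)

variable {L : PortLabeling (⊤ : SimpleGraph (Fin 2))}

theorem step_zero_dockedPair :
    step L 0 0 (dockedPair (Memory.init 2)) = dockedPair (Memory.init 2) := by
  have h : ∀ x, ¬ (dockedPair (Memory.init 2)).WaitsAt x 0 := by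
    intro x
    fin_cases x <;> simp [dockedPair, Memory.init, Config.WaitsAt, Config.Waits]
  change stepHelp 0 0 _ = _
  simp only [stepHelp, h, if_false, decide_false, Bool.or_false, false_and]
  simp only [dockedPair, Config.mk.injEq, true_and, and_true]
  funext i
  fin_cases i <;> rfl

theorem step_one_dockedPair : step L 1 0 (dockedPair (Memory.init 2)) =
    dockedPair { Memory.init 2 with phase := .await false } := by
  have h : ∃ j, (dockedPair (Memory.init 2)).DockedAt j 0 := ⟨0, rfl, rfl⟩
  change stepStart 1 0 none _ = _
  simp only [stepStart, h, or_true, if_true]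
  simp only [dockedPair, Config.mk.injEq, true_and, and_true]
  funext i
  fin_cases i <;> rfl

theorem step_one_waiting : step L 1 0 (dockedPair { Memory.init 2 with phase := .await false }) =
    dockedPair { Memory.init 2 with phase := .await false } := rfl

theorem step_zero_init : step L 0 0 (step L 0 0 (Config.init fun _ => 0)) =
    dockedPair (Memory.init 2) := by
  have h : ¬ ∃ j, (Config.init (k := 2) fun _ => (0 : Fin 2)).DockedAt j 0 := by
    rintro ⟨j, -, hj⟩
    simp [Config.init, Memory.init] at hj
  have h1 : step L 0 0 (Config.init fun _ => 0) = { Config.init (k := 2) fun _ => (0 : Fin 2) with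
      mem := ![{ Memory.init 2 with phase := .contend }, Memory.init 2] } := by
    change stepStart 0 0 none _ = _
    simp only [stepStart, h, or_false]
    simp only [Config.init, Config.mk.injEq, true_and, and_true]
    funext i
    fin_cases i <;> rfl
  rw [h1]
  change stepContend 0 0 0 _ = _
  simp only [stepContend, Config.init, dockedPair, Config.mk.injEq, true_and]
  refine ⟨?_, rfl⟩
  funext i
  fin_cases i <;> rfl

theorem exists_waits_forever (c : ℕ) : ∃ (n k : ℕ) (G : SimpleGraph (Fin n))
    (_ : DecidableRel G.Adj) (L : PortLabeling G) (s : Fin k → Fin n) (sched choice : ℕ → Fin k)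
    (i j : Fin k) (v : Fin n) (t₀ t₁ t₂ : ℕ),
    G.Connected ∧ k ≤ n ∧ i ≠ j ∧ (run L s sched choice t₀).DockedAt j v ∧
      c ≤ ((Finset.Ico t₀ t₁).filter fun t => sched t = j).card ∧
      (∀ t ≥ t₁, sched t ≠ j) ∧ (∀ i' ≠ j, ActiveForever sched i') ∧
      (∀ t ≥ t₂, (run L s sched choice t).WaitsAt i v) := by
  -- Robot `0` docks in two steps and makes `c` passes with nobody to help. Robot `1` then runs
  -- alone; its first step finds the node occupied, and from time `3 + c` on it waits.
  let sched : ℕ → Fin 2 := fun t => if t < 2 + c then 0 else 1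
  let L := someLabeling (⊤ : SimpleGraph (Fin 2))
  have hs0 : ∀ t < 2 + c, sched t = 0 := fun t ht => if_pos ht
  have hs1 : ∀ t ≥ 2 + c, sched t = 1 := fun t ht => if_neg (not_lt.2 ht)
  have hrun : ∀ t, run L (fun _ => 0) sched (fun _ => 0) (t + 1) =
      step L (sched t) 0 (run L (fun _ => 0) sched (fun _ => 0) t) := fun t => rfl
  have h2 : run L (fun _ => 0) sched (fun _ => 0) 2 = dockedPair (Memory.init 2) := by
    rw [hrun, hrun, hs0 0 (by omega), hs0 1 (by omega)]
    exact step_zero_init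
  have h3 : ∀ t ≤ c, run L (fun _ => 0) sched (fun _ => 0) (2 + t) =
      dockedPair (Memory.init 2) := by
    intro t
    induction t with
    | zero => exact fun _ => h2
    | succ t ih =>
      intro ht
      rw [← add_assoc, hrun, ih (by omega), hs0 _ (by omega), step_zero_dockedPair]
  have h4 : ∀ t ≥ 3 + c, run L (fun _ => 0) sched (fun _ => 0) t =
      dockedPair { Memory.init 2 with phase := .await false } := by
    intro t ht
    induction t, ht using Nat.le_induction with
    | base => rw [show 3 + c = 2 + c + 1 by omega, hrun, h3 c le_rfl, hs1 _ le_rfl,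
        step_one_dockedPair]
    | succ t ht ih => rw [hrun, ih, hs1 t (by omega), step_one_waiting]
  refine ⟨2, 2, ⊤, inferInstance, L, fun _ => 0, sched, fun _ => 0, 1, 0, 0, 2, 2 + c, 3 + c,
    SimpleGraph.connected_top, le_rfl, by decide, ?_, ?_, ?_, ?_, ?_⟩
  · rw [h2]
    exact ⟨rfl, rfl⟩
  · rw [Finset.filter_true_of_mem fun t ht => hs0 t (Finset.mem_Ico.1 ht).2]
    simp
  · intro t ht
    rw [hs1 t ht]
    decide
  · intro i hi t
    exact ⟨t + 2 + c, by omega, by rw [hs1 _ (by omega)]; omega⟩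
  · intro t ht
    rw [h4 t ht]
    exact ⟨rfl, by simp [dockedPair, Memory.init], .inl rfl⟩

end Stopping

end HelpingAsync

theorem theorem3 :
    -- dispersion is achieved, and every robot docks within `O(m)` steps
    (∃ C : ℕ, ∀ (V : Type u) [Fintype V] [DecidableEq V] (G : SimpleGraph V) [DecidableRel G.Adj]
      (L : HelpingAsync.PortLabeling G) (k : ℕ) (s : Fin k → V) (sched choice : ℕ → Fin k),
      G.Connected → k ≤ Fintype.card V →
        -- steps and moves of an undocked robot
        (∀ (i : Fin k) (t : ℕ),
          HelpingAsync.activeSteps L s sched choice i t ≤ C * max 1 G.edgeFinset.card ∧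
          HelpingAsync.moves L s sched choice i t + 2 * (Fintype.card V - 1)
            ≤ 4 * G.edgeFinset.card) ∧
        -- a docked robot stays docked
        (∀ (i : Fin k) (v : V) (t t' : ℕ), t ≤ t' →
          (HelpingAsync.run L s sched choice t).DockedAt i v →
          (HelpingAsync.run L s sched choice t').DockedAt i v) ∧
        -- if all robots, the docked ones included, stay active then they dock at distinct nodes
        ((∀ i, HelpingAsync.ActiveForever sched i) →
          ∃ f : Fin k → V, Function.Injective f ∧
            ∃ T : ℕ, ∀ t ≥ T, ∀ i, (HelpingAsync.run L s sched choice t).DockedAt i (f i))) ∧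
    -- the label and the memory of each robot fit into `O(k log Δ)` bits
    (∃ C : ℕ, ∀ k Δ : ℕ, 1 ≤ k → ∃ (B : ℕ) (decode : (Fin B → Bool) → Fin k × HelpingAsync.Memory k),
      (B : ℝ) ≤ C * (k * max 1 (Real.logb 2 Δ)) ∧
      ∀ (V : Type u) [Fintype V] [DecidableEq V] (G : SimpleGraph V) [DecidableRel G.Adj]
        (L : HelpingAsync.PortLabeling G) (s : Fin k → V) (sched choice : ℕ → Fin k),
        G.Connected → k ≤ Fintype.card V → G.maxDegree ≤ Δ →
          ∀ (i : Fin k) (t : ℕ), ∃ bits : Fin B → Bool,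
            decode bits = (i, (HelpingAsync.run L s sched choice t).mem i)) ∧
    -- no bound on the number of its steps after which a docked robot may stop
    (∀ c : ℕ, ∃ (n k : ℕ) (G : SimpleGraph (Fin n)) (_ : DecidableRel G.Adj)
      (L : HelpingAsync.PortLabeling G) (s : Fin k → Fin n) (sched choice : ℕ → Fin k)
      (i j : Fin k) (v : Fin n) (t₀ t₁ t₂ : ℕ),
      G.Connected ∧ k ≤ n ∧ i ≠ j ∧
      -- robot `j` docks and then takes at least `c` further steps, but not infinitely many
      (HelpingAsync.run L s sched choice t₀).DockedAt j v ∧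
      c ≤ ((Finset.Ico t₀ t₁).filter fun t => sched t = j).card ∧
      (∀ t ≥ t₁, sched t ≠ j) ∧
      (∀ i' ≠ j, HelpingAsync.ActiveForever sched i') ∧
      -- and then robot `i` stays undocked forever, at the node of robot `j`
      (∀ t ≥ t₂, (HelpingAsync.run L s sched choice t).WaitsAt i v)) := by
  refine ⟨⟨19, ?_⟩, ⟨14, fun k Δ hk => ?_⟩, HelpingAsync.exists_waits_forever⟩
  · intro V _ _ G _ L k s sched choice hG hk
    exact ⟨fun i t => ⟨HelpingAsync.activeSteps_le_edges hG hk i t,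
      HelpingAsync.moves_le hG hk i t⟩, fun i v t t' => HelpingAsync.docked_run,
      HelpingAsync.dispersion hG hk⟩
  · obtain ⟨B, decode, hB, h⟩ := HelpingAsync.exists_decode k Δ hk
    refine ⟨B, decode, hB, ?_⟩
    intro V _ _ G _ L s sched choice hG hk hΔ i t
    exact h i _ ((HelpingAsync.bounded_run hG hk hΔ t).mem i)
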